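/- For integers $m,j,n\ge 0$ let $Q_{m,j}(n)$ denote the number of pairs $(\mu,\lambda)$ of total size $n$ (i.e. $|\mu|+|\lambda|=n$), where $\mu$ is an overpartition into even parts $\le 2m$ with exactly $j$ parts, and $\lambda$ is a partition into odd parts $\le 2m+1$ such that every odd number $<2m+1$ appears as a part, an even (positive) number of times, while the part $2m+1$ may appear any number of times or not at all. (An overpartition is a partition in which the first occurrence of each part size may be overlined; parts are counted with multiplicity; empty partitions are allowed.) Let $q\in\mathbb{C}$ with $0<|q|<1$, let $q^{1/2}$ be either square root of $q$, and put $q^{k/2}=(q^{1/2})^k$ for integers $k\ge 0$. Then the series below converge absolutely and $$\sum_{m,n,j\ge0}(-1)^jQ_{m,j}(n)q^n= \frac{1}{2}\sum_{n\ge0}q^{3n^2/2}(1+q^{2n+1})(1+q^{n+1/2})\sum_{|j|\le n}q^{j^2/2}+\frac{1}{2}\sum_{n\ge0}(-1)^nq^{3n^2/2}(1+q^{2n+1})(1-q^{n+1/2})\sum_{|j|\le n}(-1)^jq^{j^2/2}.$$ -/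

import Mathlib

/-- An overpartition of `n`: a partition of `n` together with the set of those part sizes whose
first occurrence is overlined. -/
structure Overpartition (n : ℕ) where
  /-- The underlying partition of `n`. -/
  toPartition : Nat.Partition n
  /-- The part sizes whose first occurrence is overlined. -/
  overlined : Finset ℕ
  overlined_subset : overlined ⊆ toPartition.parts.toFinset

instance Overpartition.instFinite (n : ℕ) : Finite (Overpartition n) :=
  Finite.of_injective
    (fun μ : Overpartition n =>
      (⟨μ.toPartition, ⟨μ.overlined, Finset.mem_powerset.2 μ.overlined_subset⟩⟩ :
        Σ p : Nat.Partition n, {s : Finset ℕ // s ∈ p.parts.toFinset.powerset}))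
    (by
      rintro ⟨p, s, hs⟩ ⟨p', s', hs'⟩ h
      simp only [Sigma.mk.injEq] at h
      obtain ⟨rfl, h⟩ := h
      simpa using h)

/-- `μ` is an overpartition into even parts `≤ 2m` with exactly `j` parts
(counted with multiplicity). -/
def Overpartition.IsEvenBounded {a : ℕ} (m j : ℕ) (μ : Overpartition a) : Prop :=
  (∀ i ∈ μ.toPartition.parts, Even i ∧ i ≤ 2 * m) ∧ Multiset.card μ.toPartition.parts = j

/-- `l` is a partition into odd parts `≤ 2m + 1` in which every odd number `< 2m + 1` appears,
and appears an even number of times; `2m + 1` may appear any number of times, or not at all. -/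
def IsOddEvenlyRepeated {b : ℕ} (m : ℕ) (l : Nat.Partition b) : Prop :=
  (∀ i ∈ l.parts, Odd i ∧ i ≤ 2 * m + 1) ∧
    ∀ i : ℕ, Odd i → i < 2 * m + 1 → i ∈ l.parts ∧ Even (l.parts.count i)

/-- The number `Q_{m,j}(n)` of pairs `(μ, l)` of total size `n`, where `μ` is an overpartition into
even parts `≤ 2m` with `j` parts and `l` is a partition as in `IsOddEvenlyRepeated m`. -/
noncomputable def overpartitionPairCount (m j n : ℕ) : ℕ :=
  Nat.card {x : Σ p : Finset.HasAntidiagonal.antidiagonal n,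
      Overpartition p.1.1 × Nat.Partition p.1.2 //
      x.2.1.IsEvenBounded m j ∧ IsOddEvenlyRepeated m x.2.2}

/-! Both sides equal `(A + 2) / 3 + q * C / 3`, where A and C are the hexagonal lattice sums of `q ^
hexForm x` and `q ^ hexFormShift x`.

Left side. Put Q = q². For fixed m the pairs have a product generating function. Weighting each even
part by -1 collapses it to (1 + q^(2m+1)) Q^(m²) (Q;Q)_m² / (Q;Q)_(2m+1) (`pairGenFun_neg_one`), so
two series must be summed, with exponents m² and m² + m. A finite Jacobi triple product, specialised
at z = 1, expands (Q;Q)_m² / (Q;Q)_(2m+1) as a sum over j of terms with denominator (Q;Q)_(m-j)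
(Q;Q)_(m+1+j) (`qPoch_sq_div`). After interchanging the sums, the inner ones are Durfee rectangle
series for 1/(Q;Q)_∞ (`tsum_durfeeTerm`, `tsum_durfeeTermShift`), and single theta series divided by
(Q;Q)_∞ remain.

These quotients become lattice sums by cubing θ(z) = ∑ (-1)^k z^k q^(k(k-1)) and sorting the terms
by the total exponent of z modulo 3 (`tsum_thetaTerm_cube`). A primitive cube root of unity for z
gives C as an eta quotient (`tsum_hexFormShift_mul`). The z-derivative of the cube at z = 1
vanishes, because θ(1) = 0, and this gives the ratio of A to C (`tsum_hexForm_relation`).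

Right side. The half-sum of the two series separates the parities of n + j. Substituting n = x + y,
j = x - y (with n lowered by one in the odd case) turns the double sums into sums of the same
quadratic forms over quadrants. By the rotational symmetry of the lattice these quadrants account
for (A + 2)/3 and C/3 (`hasSum_hexForm_cone`, `hasSum_hexFormShift_cone`, `tsum_half_series`). -/

/-- The `q`-factorial `(q; q)_n`. -/
noncomputable def qPoch (q : ℂ) (n : ℕ) : ℂ := ∏ k ∈ Finset.range n, (1 - q ^ (k + 1))

/-- The infinite product `(q; q)_∞`. -/
noncomputable def qInf (q : ℂ) : ℂ := ∏' k : ℕ, (1 - q ^ (k + 1))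

/-! ### Finite and infinite q-factorials -/

section QPoch

open Filter Topology

variable {q : ℂ}

@[simp] lemma qPoch_zero : qPoch q 0 = 1 := by simp [qPoch]

lemma qPoch_succ (n : ℕ) : qPoch q (n + 1) = qPoch q n * (1 - q ^ (n + 1)) := by
  simp [qPoch, Finset.prod_range_succ]

lemma one_sub_pow_ne_zero (hq : ‖q‖ < 1) {k : ℕ} (hk : k ≠ 0) : 1 - q ^ k ≠ 0 := by
  intro h
  have h1 : ‖q ^ k‖ = 1 := by rw [← sub_eq_zero.1 h, norm_one]
  rw [norm_pow] at h1
  exact (pow_lt_one₀ (norm_nonneg q) hq hk).ne h1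

lemma one_add_pow_ne_zero (hq : ‖q‖ < 1) {k : ℕ} (hk : k ≠ 0) : 1 + q ^ k ≠ 0 := by
  intro h
  have h1 : ‖q ^ k‖ = 1 := by
    rw [show q ^ k = -1 by linear_combination h, norm_neg, norm_one]
  rw [norm_pow] at h1
  exact (pow_lt_one₀ (norm_nonneg q) hq hk).ne h1

lemma qPoch_ne_zero (hq : ‖q‖ < 1) (n : ℕ) : qPoch q n ≠ 0 :=
  Finset.prod_ne_zero_iff.2 fun _ _ => one_sub_pow_ne_zero hq (Nat.succ_ne_zero _)

lemma summable_norm_neg_pow_succ (hq : ‖q‖ < 1) : Summable fun k : ℕ => ‖-q ^ (k + 1)‖ := by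
  simp only [norm_neg, norm_pow]
  exact (summable_nat_add_iff 1).2 (summable_geometric_of_lt_one (norm_nonneg q) hq)

lemma tendsto_qPoch (hq : ‖q‖ < 1) : Tendsto (qPoch q) atTop (𝓝 (qInf q)) := by
  have h : Multipliable fun k : ℕ => 1 - q ^ (k + 1) := by
    simpa [sub_eq_add_neg] using multipliable_one_add_of_summable (summable_norm_neg_pow_succ hq)
  exact h.hasProd.tendsto_prod_nat

lemma qInf_ne_zero (hq : ‖q‖ < 1) : qInf q ≠ 0 := by
  have := tprod_one_add_ne_zero_of_summable (f := fun k : ℕ => -q ^ (k + 1))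
    (fun k => by
      simpa [sub_eq_add_neg] using one_sub_pow_ne_zero hq (Nat.succ_ne_zero k))
    (summable_norm_neg_pow_succ hq)
  simpa [qInf, sub_eq_add_neg] using this

lemma exists_norm_qPoch_inv_le (hq : ‖q‖ < 1) : ∃ B : ℝ, 0 < B ∧ ∀ n, ‖(qPoch q n)⁻¹‖ ≤ B := by
  obtain ⟨B, hB⟩ := ((tendsto_qPoch hq).inv₀ (qInf_ne_zero hq)).norm.bddAbove_range
  refine ⟨max B 1, by positivity, fun n => le_max_of_le_left (hB ⟨n, rfl⟩)⟩

/-- `1 / (q; q)_k` for an integer `k`, zero for negative `k`. -/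
noncomputable def qPochInv (q : ℂ) (k : ℤ) : ℂ := if k < 0 then 0 else (qPoch q k.toNat)⁻¹

lemma qPochInv_of_neg {k : ℤ} (hk : k < 0) : qPochInv q k = 0 := if_pos hk

lemma qPochInv_natCast (n : ℕ) : qPochInv q n = (qPoch q n)⁻¹ := by simp [qPochInv]

/-- The zero convention makes the recurrence hold at every integer: at k = 0 the factor 1 - q^0
vanishes. No boundary cases are therefore needed in the recurrences below. -/
lemma qPochInv_sub_one (hq : ‖q‖ < 1) (k : ℤ) :
    qPochInv q (k - 1) = (1 - q ^ k) * qPochInv q k := by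
  rcases lt_or_ge k 0 with hk | hk
  · rw [qPochInv_of_neg hk, qPochInv_of_neg (by lia), mul_zero]
  · obtain ⟨n, rfl⟩ := Int.eq_ofNat_of_zero_le hk
    rcases n with _ | n
    · simp [qPochInv]
    · have h1 := qPoch_ne_zero hq n
      have h2 := one_sub_pow_ne_zero hq (Nat.succ_ne_zero n)
      rw [qPochInv_natCast, show ((n + 1 : ℕ) : ℤ) - 1 = n by push_cast; ring, qPochInv_natCast,
        qPoch_succ, zpow_natCast]
      field_simp

end QPoch

/-! ### A finite form of the Jacobi triple product -/

section FiniteTripleProduct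

open Filter Topology

variable {p : ℂ}

/-- The coefficients of the finite form of Jacobi's triple product, `q = p ^ 2`. -/
noncomputable def tripleCoeff (p : ℂ) (n : ℕ) (j : ℤ) : ℂ :=
  (-1) ^ j * p ^ (j * (j + 1)) * qPochInv (p ^ 2) (n - j) * qPochInv (p ^ 2) (n + 1 + j)

lemma tripleCoeff_of_lt {n : ℕ} {j : ℤ} (h : n < j) : tripleCoeff p n j = 0 := by
  simp [tripleCoeff, qPochInv_of_neg (show (n : ℤ) - j < 0 by lia)]

lemma norm_sq_lt_one (hp : ‖p‖ < 1) : ‖p ^ 2‖ < 1 := by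
  rw [norm_pow]; exact pow_lt_one₀ (norm_nonneg p) hp two_ne_zero

/-- All the coefficients are multiples of 1/(Q;Q)_(n+1-j) and 1/(Q;Q)_(n+2+j), Q = p², so this is a
polynomial identity in p^j. It encodes multiplication of the finite product by (1 - zQ^(n+1))(1 -
Q^(n+1)/z), which accounts for the neighbours j ± 1. -/
lemma tripleCoeff_succ (hp0 : p ≠ 0) (hp : ‖p‖ < 1) (n : ℕ) (j : ℤ) :
    (1 - (p ^ 2) ^ (2 * n + 2)) * (1 - (p ^ 2) ^ (2 * n + 3)) * tripleCoeff p (n + 1) j =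
      (1 + (p ^ 2) ^ (2 * n + 2)) * tripleCoeff p n j -
        (p ^ 2) ^ (n + 1) * (tripleCoeff p n (j - 1) + tripleCoeff p n (j + 1)) := by
  have hq := norm_sq_lt_one hp
  have hq0 : p ^ 2 ≠ 0 := pow_ne_zero 2 hp0
  have e1 := qPochInv_sub_one hq (n + 1 - j)
  have e2 := qPochInv_sub_one hq (n - j)
  have e3 := qPochInv_sub_one hq (n + 2 + j)
  have e4 := qPochInv_sub_one hq (n + 1 + j)
  rw [show (n : ℤ) + 1 - j - 1 = n - j by ring] at e1
  rw [show (n : ℤ) + 2 + j - 1 = n + 1 + j by ring] at e3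
  rw [show (n : ℤ) + 1 + j - 1 = n + j by ring] at e4
  simp only [tripleCoeff]
  rw [show ((n + 1 : ℕ) : ℤ) - j = n + 1 - j by push_cast; ring,
    show ((n + 1 : ℕ) : ℤ) + 1 + j = n + 2 + j by push_cast; ring,
    show (n : ℤ) - (j - 1) = n + 1 - j by ring, show (n : ℤ) + 1 + (j - 1) = n + j by ring,
    show (n : ℤ) - (j + 1) = n - j - 1 by ring, show (n : ℤ) + 1 + (j + 1) = n + 2 + j by ring,
    e4, e2, e3, e1]
  generalize qPochInv (p ^ 2) (n + 1 - j) = B1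
  generalize qPochInv (p ^ 2) (n + 2 + j) = B2
  have hy : p ^ j ≠ 0 := zpow_ne_zero _ hp0
  have hj : (p ^ 2 : ℂ) ^ j = (p ^ j) ^ 2 := by
    rw [← zpow_natCast, ← zpow_natCast, ← zpow_mul, ← zpow_mul, mul_comm]
  have f1 : (p ^ 2 : ℂ) ^ ((n : ℤ) + 1 - j) = (p ^ 2) ^ n * p ^ 2 / (p ^ j) ^ 2 := by
    rw [zpow_sub₀ hq0, zpow_add₀ hq0, zpow_natCast, zpow_one, hj]
  have f2 : (p ^ 2 : ℂ) ^ ((n : ℤ) - j) = (p ^ 2) ^ n / (p ^ j) ^ 2 := by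
    rw [zpow_sub₀ hq0, zpow_natCast, hj]
  have f3 : (p ^ 2 : ℂ) ^ ((n : ℤ) + 2 + j) = (p ^ 2) ^ n * p ^ 4 * (p ^ j) ^ 2 := by
    rw [zpow_add₀ hq0, zpow_add₀ hq0, zpow_natCast, hj, zpow_ofNat, ← pow_mul p 2 2]
  have f4 : (p ^ 2 : ℂ) ^ ((n : ℤ) + 1 + j) = (p ^ 2) ^ n * p ^ 2 * (p ^ j) ^ 2 := by
    rw [zpow_add₀ hq0, zpow_add₀ hq0, zpow_natCast, zpow_one, hj]
  have g1 : p ^ ((j - 1) * (j - 1 + 1)) = p ^ (j * (j + 1)) / (p ^ j) ^ 2 := by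
    rw [show (j - 1) * (j - 1 + 1) = j * (j + 1) - j * 2 by ring, zpow_sub₀ hp0, zpow_mul p j 2]
    norm_cast
  have g2 : p ^ ((j + 1) * (j + 1 + 1)) = p ^ (j * (j + 1)) * (p ^ j) ^ 2 * p ^ 2 := by
    rw [show (j + 1) * (j + 1 + 1) = j * (j + 1) + j * 2 + 2 by ring, zpow_add₀ hp0, zpow_add₀ hp0,
      zpow_mul p j 2]
    norm_cast
  have s1 : (-1 : ℂ) ^ (j - 1) = -(-1) ^ j := by
    rw [zpow_sub_one₀ (by norm_num)]; norm_num
  have s2 : (-1 : ℂ) ^ (j + 1) = -(-1) ^ j := by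
    rw [zpow_add_one₀ (by norm_num)]; norm_num
  rw [f1, f2, f3, f4, g1, g2, s1, s2]
  generalize p ^ (j * (j + 1)) = G
  generalize (-1 : ℂ) ^ j = s
  generalize p ^ j = y at *
  field_simp
  ring

/-- Three-term recurrences in `j` are summed up to boundary terms. -/
lemma sum_tripleCoeff_neighbours (n : ℕ) {w : ℕ → ℂ} {t : ℂ} (h0 : w 0 = 1) (h1 : w 1 = t + 1)
    (hw : ∀ j, w (j + 2) = t * w (j + 1) - w j) (M : ℕ) :
    ∑ j ∈ Finset.range (M + 1), (tripleCoeff p n ((j : ℤ) - 1) + tripleCoeff p n ((j : ℤ) + 1)) * w j =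
      t * ∑ j ∈ Finset.range (M + 1), tripleCoeff p n j * w j +
        tripleCoeff p n ((M : ℤ) + 1) * w M - tripleCoeff p n M * w (M + 1) := by
  induction M with
  | zero =>
    -- The coefficients are antisymmetric under j ↦ -1 - j. The recurrence extends w by w(-1) = t -
    -- (t + 1) = -1, so only the upper boundary contributes.
    have h : tripleCoeff p n (-1) = -tripleCoeff p n 0 := by
      simp [tripleCoeff]; ring
    simp [h0, h1, h]; ring
  | succ M ih =>
    rw [Finset.sum_range_succ, ih, Finset.sum_range_succ _ (M + 1), hw]
    push_cast
    rw [add_sub_cancel_right]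
    ring

/-- A finite form of Jacobi's triple product. -/
lemma sum_tripleCoeff (hp0 : p ≠ 0) (hp : ‖p‖ < 1) {w : ℕ → ℂ} {t : ℂ} (h0 : w 0 = 1)
    (h1 : w 1 = t + 1) (hw : ∀ j, w (j + 2) = t * w (j + 1) - w j) (n : ℕ) :
    ∑ j ∈ Finset.range (n + 1), tripleCoeff p n j * w j =
      (∏ k ∈ Finset.range n, (1 - t * (p ^ 2) ^ (k + 1) + (p ^ 2) ^ (2 * (k + 1)))) /
        qPoch (p ^ 2) (2 * n + 1) := by
  -- With t = z + 1/z one has w j = z^(-j) + ... + z^j, and the factors on the right are (1 -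
  -- zQ^(k+1))(1 - Q^(k+1)/z).
  have hq := norm_sq_lt_one hp
  induction n with
  | zero =>
    simp [tripleCoeff, h0, qPochInv]
  | succ n ih =>
    have a1 := one_sub_pow_ne_zero hq (show 2 * n + 2 ≠ 0 by lia)
    have a2 := one_sub_pow_ne_zero hq (show 2 * n + 3 ≠ 0 by lia)
    have a3 := qPoch_ne_zero hq (2 * n + 1)
    have key : (1 - (p ^ 2) ^ (2 * n + 2)) * (1 - (p ^ 2) ^ (2 * n + 3)) *
        ∑ j ∈ Finset.range (n + 1 + 1), tripleCoeff p (n + 1) j * w j =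
        (1 - t * (p ^ 2) ^ (n + 1) + (p ^ 2) ^ (2 * (n + 1))) *
          ∑ j ∈ Finset.range (n + 1), tripleCoeff p n j * w j := by
      have hz : tripleCoeff p n ((n : ℤ) + 1) = 0 := tripleCoeff_of_lt (by lia)
      have hz' : tripleCoeff p n ((n : ℤ) + 1 + 1) = 0 := tripleCoeff_of_lt (by lia)
      have hn := sum_tripleCoeff_neighbours (p := p) n h0 h1 hw (n + 1)
      push_cast at hn
      rw [hz, hz', zero_mul, zero_mul, add_zero, sub_zero] at hn
      have hS : ∑ j ∈ Finset.range (n + 1 + 1), tripleCoeff p n j * w j =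
          ∑ j ∈ Finset.range (n + 1), tripleCoeff p n j * w j := by
        rw [Finset.sum_range_succ]; push_cast; rw [hz]; ring
      rw [← hS, Finset.mul_sum]
      have : ∀ j ∈ Finset.range (n + 1 + 1),
          (1 - (p ^ 2) ^ (2 * n + 2)) * (1 - (p ^ 2) ^ (2 * n + 3)) *
            (tripleCoeff p (n + 1) j * w j) =
          (1 + (p ^ 2) ^ (2 * n + 2)) * (tripleCoeff p n j * w j) - (p ^ 2) ^ (n + 1) *
            ((tripleCoeff p n ((j : ℤ) - 1) + tripleCoeff p n ((j : ℤ) + 1)) * w j) := by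
        intro j _
        linear_combination w j * tripleCoeff_succ hp0 hp n j
      rw [Finset.sum_congr rfl this, Finset.sum_sub_distrib, ← Finset.mul_sum, ← Finset.mul_sum, hn]
      ring
    rw [ih] at key
    rw [Finset.prod_range_succ, show 2 * (n + 1) + 1 = 2 * n + 1 + 1 + 1 by ring, qPoch_succ,
      qPoch_succ]
    rw [eq_div_iff (mul_ne_zero (mul_ne_zero a3 a1) a2)]
    rw [mul_div_assoc', eq_div_iff a3] at key
    linear_combination key

end FiniteTripleProduct

/-! ### Limiting cases: Jacobi's cube identity and a cube root of unity -/

section Limits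

open Filter Topology

lemma tendsto_qPochInv {q : ℂ} (hq : ‖q‖ < 1) :
    Tendsto (qPochInv q) atTop (𝓝 (qInf q)⁻¹) := by
  have h : Tendsto (fun k : ℤ => (qPoch q k.toNat)⁻¹) atTop (𝓝 (qInf q)⁻¹) :=
    ((tendsto_qPoch hq).inv₀ (qInf_ne_zero hq)).comp
      (tendsto_atTop.2 fun b => (eventually_ge_atTop (b : ℤ)).mono fun k hk => by lia)
  refine h.congr' ((eventually_ge_atTop 0).mono fun k hk => ?_)
  simp [qPochInv, not_lt.2 hk]

lemma exists_norm_qPochInv_le {q : ℂ} (hq : ‖q‖ < 1) :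
    ∃ B : ℝ, 0 < B ∧ ∀ k, ‖qPochInv q k‖ ≤ B := by
  obtain ⟨B, hB0, hB⟩ := exists_norm_qPoch_inv_le hq
  refine ⟨B, hB0, fun k => ?_⟩
  unfold qPochInv
  split_ifs
  · simpa using hB0.le
  · exact hB _

lemma summable_succ_mul_geometric {ρ : ℝ} (h0 : 0 ≤ ρ) (h1 : ρ < 1) :
    Summable fun j : ℕ => ((j : ℝ) + 1) * ρ ^ j := by
  have h2 : ‖ρ‖ < 1 := by rwa [Real.norm_of_nonneg h0]
  have := summable_pow_mul_geometric_of_norm_lt_one 1 h2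
  simp only [add_mul, one_mul]
  simp only [pow_one] at this
  exact this.add (summable_geometric_of_lt_one h0 h1)

/-- The limiting form of the finite triple product. -/
lemma hasSum_tripleProduct {p : ℂ} (hp0 : p ≠ 0) (hp : ‖p‖ < 1) {w : ℕ → ℂ} {t L : ℂ} {K : ℝ}
    (h0 : w 0 = 1) (h1 : w 1 = t + 1) (hw : ∀ j, w (j + 2) = t * w (j + 1) - w j)
    (hK : ∀ j : ℕ, ‖w j‖ ≤ K * (j + 1))
    (hL : Tendsto (fun n => ∏ k ∈ Finset.range n,
      (1 - t * (p ^ 2) ^ (k + 1) + (p ^ 2) ^ (2 * (k + 1)))) atTop (𝓝 L)) :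
    HasSum (fun j : ℕ => (-1) ^ j * p ^ (j * (j + 1)) * w j) (qInf (p ^ 2) * L) := by
  have hq := norm_sq_lt_one hp
  have hD := qInf_ne_zero hq
  obtain ⟨B, hB0, hB⟩ := exists_norm_qPochInv_le hq
  have hK0 : 0 ≤ K := by simpa using (norm_nonneg _).trans (hK 0)
  have hs := summable_succ_mul_geometric (norm_nonneg p) hp
  have hpow (j : ℕ) : ‖p‖ ^ (j * (j + 1)) ≤ ‖p‖ ^ j :=
    pow_le_pow_of_le_one (norm_nonneg p) hp.le (Nat.le_mul_of_pos_right j (Nat.succ_pos j))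
  have hsum : Summable fun j : ℕ => (-1) ^ j * p ^ (j * (j + 1)) * w j := by
    refine Summable.of_norm_bounded (hs.mul_left K) fun j => ?_
    rw [norm_mul, norm_mul, norm_pow, norm_neg, norm_one, one_pow, one_mul, norm_pow]
    calc ‖p‖ ^ (j * (j + 1)) * ‖w j‖ ≤ ‖p‖ ^ j * (K * (j + 1)) :=
          mul_le_mul (hpow j) (hK j) (norm_nonneg _) (by positivity)
      _ = _ := by ring
  have hz (j : ℕ) : (p : ℂ) ^ ((j : ℤ) * (j + 1)) = p ^ (j * (j + 1)) := by
    rw [← zpow_natCast]; push_cast; rfl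
  -- Tannery's theorem: both reciprocal q-factorials tend to 1/(Q;Q)_∞ and are uniformly bounded,
  -- while p^(j(j+1)) dominates the linear growth of w.
  have key : Tendsto (fun n : ℕ => ∑' j : ℕ, tripleCoeff p n j * w j) atTop
      (𝓝 (∑' j : ℕ, (-1) ^ j * p ^ (j * (j + 1)) * w j * ((qInf (p ^ 2))⁻¹ * (qInf (p ^ 2))⁻¹))) := by
    refine tendsto_tsum_of_dominated_convergence (bound := fun j : ℕ => K * B * B *
      (((j : ℝ) + 1) * ‖p‖ ^ j)) (hs.mul_left _) (fun j => ?_) (Eventually.of_forall fun n j => ?_)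
    · have t1 : Tendsto (fun n : ℕ => qPochInv (p ^ 2) ((n : ℤ) - j)) atTop (𝓝 (qInf (p ^ 2))⁻¹) :=
        (tendsto_qPochInv hq).comp
          (tendsto_atTop_add_const_right _ _ tendsto_natCast_atTop_atTop)
      have t2 : Tendsto (fun n : ℕ => qPochInv (p ^ 2) ((n : ℤ) + 1 + j)) atTop
          (𝓝 (qInf (p ^ 2))⁻¹) := by
        simp only [add_assoc]
        exact (tendsto_qPochInv hq).comp
          (tendsto_atTop_add_const_right _ _ tendsto_natCast_atTop_atTop)
      have := ((t1.mul t2).const_mul ((-1) ^ j * p ^ (j * (j + 1)))).mul_const (w j)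
      convert this using 1
      · ext n
        simp only [tripleCoeff, hz, zpow_natCast]
        ring
      · congr 1; ring
    · rw [tripleCoeff, hz, zpow_natCast, norm_mul, norm_mul, norm_mul, norm_mul, norm_pow, norm_neg,
        norm_one, one_pow, one_mul, norm_pow]
      calc ‖p‖ ^ (j * (j + 1)) * ‖qPochInv (p ^ 2) (n - j)‖ * ‖qPochInv (p ^ 2) (n + 1 + j)‖ * ‖w j‖
          ≤ ‖p‖ ^ j * B * B * (K * (j + 1)) := by
            have := hpow j
            gcongr
            exacts [hB _, hB _, hK j]
        _ = _ := by ring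
  have hfin (n : ℕ) : ∑' j : ℕ, tripleCoeff p n j * w j =
      (∏ k ∈ Finset.range n, (1 - t * (p ^ 2) ^ (k + 1) + (p ^ 2) ^ (2 * (k + 1)))) /
        qPoch (p ^ 2) (2 * n + 1) := by
    rw [← sum_tripleCoeff hp0 hp h0 h1 hw n]
    refine tsum_eq_sum fun j hj => ?_
    rw [tripleCoeff_of_lt (by simpa using hj), zero_mul]
  simp only [hfin] at key
  have h2n : Tendsto (fun n : ℕ => qPoch (p ^ 2) (2 * n + 1)) atTop (𝓝 (qInf (p ^ 2))) :=
    (tendsto_qPoch hq).comp (tendsto_atTop_mono (fun n => show n ≤ 2 * n + 1 by lia) tendsto_id)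
  have := tendsto_nhds_unique key (hL.div h2n hD)
  rw [tsum_mul_right] at this
  convert hsum.hasSum using 1
  field_simp at this
  linear_combination -this

/-- Jacobi's formula for the cube of the Euler function. -/
lemma hasSum_qInf_cube {p : ℂ} (hp0 : p ≠ 0) (hp : ‖p‖ < 1) :
    HasSum (fun j : ℕ => (-1) ^ j * p ^ (j * (j + 1)) * (2 * j + 1)) (qInf (p ^ 2) ^ 3) := by
  -- The case z = 1.
  have h := hasSum_tripleProduct hp0 hp (w := fun j => 2 * j + 1) (t := 2) (K := 2)
    (L := qInf (p ^ 2) ^ 2) (by simp) (by norm_num) (fun j => by push_cast; ring) (fun j => ?_) ?_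
  · convert h using 1; ring
  · have : ‖(2 * j + 1 : ℂ)‖ = 2 * j + 1 := by
      have := Complex.norm_natCast (2 * j + 1)
      push_cast at this
      exact this
    rw [this]; linarith
  · convert (tendsto_qPoch (norm_sq_lt_one hp)).pow 2 using 2 with n
    rw [qPoch, ← Finset.prod_pow]
    exact Finset.prod_congr rfl fun k _ => by ring

/-- The case z = ω, t = -1: each factor is 1 + x + x² = (1 - x³)/(1 - x), so the product is
(p⁶;p⁶)_∞ / (p²;p²)_∞. -/
lemma hasSum_tripleProduct_cubeRoot {p ω : ℂ} (hp0 : p ≠ 0) (hp : ‖p‖ < 1)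
    (hω : ω ^ 2 + ω + 1 = 0) :
    HasSum (fun j : ℕ => (-1) ^ j * p ^ (j * (j + 1)) * (ω ^ (2 * j) - ω ^ (j + 1)))
      ((1 - ω) * qInf (p ^ 6)) := by
  have hq := norm_sq_lt_one hp
  have hω1 : 1 - ω ≠ 0 := by
    intro h
    rw [show ω = 1 by linear_combination -h] at hω
    norm_num at hω
  have hω3 : ω ^ 3 = 1 := by linear_combination (ω - 1) * hω
  have hn : ‖ω‖ = 1 := by
    have : ‖ω‖ ^ 3 = 1 := by rw [← norm_pow, hω3, norm_one]
    exact (pow_eq_one_iff_of_nonneg (norm_nonneg _) three_ne_zero).1 this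
  have h := hasSum_tripleProduct hp0 hp (w := fun j => (ω ^ (2 * j) - ω ^ (j + 1)) / (1 - ω))
    (t := -1) (K := 2 / ‖1 - ω‖) (L := qInf (p ^ 6) / qInf (p ^ 2)) ?_ ?_ (fun j => ?_)
    (fun j => ?_) ?_
  · have hD := qInf_ne_zero hq
    have h' := h.mul_left (1 - ω)
    rw [mul_div_cancel₀ _ hD] at h'
    refine h'.congr_fun fun j => ?_
    field_simp
  · simp [hω1]
  · simp only [mul_one]
    rw [show ω ^ (1 + 1) = ω ^ 2 by ring]; simp
  · field_simp
    ring_nf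
    linear_combination (ω ^ (j * 2) * (ω ^ 2 - ω + 1) - ω * ω ^ j) * hω
  · rw [norm_div]
    have h2 : ‖ω ^ (2 * j) - ω ^ (j + 1)‖ ≤ 2 := by
      refine (norm_sub_le _ _).trans ?_
      rw [norm_pow, norm_pow, hn, one_pow, one_pow]; norm_num
    have h3 : 2 / ‖1 - ω‖ * 1 ≤ 2 / ‖1 - ω‖ * ((j : ℝ) + 1) := by
      gcongr
      linarith [show (0 : ℝ) ≤ j from Nat.cast_nonneg j]
    refine le_trans ?_ h3
    rw [mul_one]
    gcongr
  · have h6 : ‖p ^ 6‖ < 1 := by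
      rw [norm_pow]; exact pow_lt_one₀ (norm_nonneg p) hp (by norm_num)
    refine ((tendsto_qPoch h6).div (tendsto_qPoch hq) (qInf_ne_zero hq)).congr fun n => ?_
    simp only [Pi.div_apply]
    rw [qPoch, qPoch, ← Finset.prod_div_distrib]
    refine Finset.prod_congr rfl fun k _ => ?_
    rw [div_eq_iff (one_sub_pow_ne_zero hq (Nat.succ_ne_zero k)), Nat.succ_eq_add_one]
    ring

end Limits

/-! ### Durfee rectangle series for 1/(q;q)_∞ -/

section DurfeeSums

open Filter Topology

variable {q : ℂ}

/-- Terms of the Durfee rectangle expansion of `1 / (q; q)_∞`. -/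
noncomputable def durfeeTerm (q : ℂ) (c N : ℕ) : ℂ :=
  q ^ (N ^ 2 + N * c) * (qPoch q N)⁻¹ * (qPoch q (N + c))⁻¹

lemma exists_norm_durfeeTerm_le (hq : ‖q‖ < 1) :
    ∃ B : ℝ, 0 < B ∧ ∀ c N, ‖durfeeTerm q c N‖ ≤ B * ‖q‖ ^ N := by
  obtain ⟨B, hB0, hB⟩ := exists_norm_qPoch_inv_le hq
  refine ⟨B * B, by positivity, fun c N => ?_⟩
  rw [durfeeTerm, norm_mul, norm_mul, norm_pow]
  calc ‖q‖ ^ (N ^ 2 + N * c) * ‖(qPoch q N)⁻¹‖ * ‖(qPoch q (N + c))⁻¹‖ ≤ ‖q‖ ^ N * B * B := by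
        have := pow_le_pow_of_le_one (norm_nonneg q) hq.le
          ((Nat.le_self_pow two_ne_zero N).trans (Nat.le_add_right _ (N * c)))
        gcongr
        · exact hB _
        · exact hB _
    _ = _ := by ring

lemma summable_durfeeTerm (hq : ‖q‖ < 1) (c : ℕ) : Summable (durfeeTerm q c) := by
  obtain ⟨B, -, hB⟩ := exists_norm_durfeeTerm_le hq
  exact Summable.of_norm_bounded ((summable_geometric_of_lt_one (norm_nonneg q) hq).mul_left B)
    (hB c)

/-- The variant of `durfeeTerm` with the second factor shifted by one. -/
noncomputable def durfeeTermShift (q : ℂ) (c N : ℕ) : ℂ :=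
  q ^ (N ^ 2 + N * c) * (qPoch q N)⁻¹ * (qPoch q (N + c + 1))⁻¹

lemma durfeeTermShift_eq (hq : ‖q‖ < 1) (c N : ℕ) :
    durfeeTermShift q c N = durfeeTerm q c N + q ^ (c + 1) * durfeeTerm q (c + 1) N := by
  have h1 := qPoch_ne_zero hq N
  have h2 := qPoch_ne_zero hq (N + c)
  have h3 := one_sub_pow_ne_zero hq (Nat.succ_ne_zero (N + c))
  rw [durfeeTermShift, durfeeTerm, durfeeTerm, ← add_assoc, qPoch_succ]
  rw [Nat.succ_eq_add_one] at h3
  field_simp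
  ring

/-- Two evaluations of the shifted sum. One is `durfeeTermShift_eq`; in the other, subtracting the
series at c + 1 leaves a factor 1 - q^N, which cancels in (q;q)_N, and N moves by one. -/
lemma tsum_durfeeTerm_recurrence (hq : ‖q‖ < 1) (c : ℕ) :
    ∑' N, durfeeTerm q c N + q ^ (c + 1) * ∑' N, durfeeTerm q (c + 1) N =
      ∑' N, durfeeTerm q (c + 1) N + q ^ (c + 1) * ∑' N, durfeeTerm q (c + 2) N := by
  have s0 := summable_durfeeTerm hq c
  have s1 := summable_durfeeTerm hq (c + 1)
  have s2 := summable_durfeeTerm hq (c + 2)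
  have sT : Summable (durfeeTermShift q c) := by
    simpa only [funext (durfeeTermShift_eq hq c)] using s0.add (s1.mul_left (q ^ (c + 1)))
  have hd : ∑' N, (durfeeTermShift q c N - durfeeTerm q (c + 1) N) =
      q ^ (c + 1) * ∑' N, durfeeTerm q (c + 2) N := by
    rw [(sT.sub s1).tsum_eq_zero_add, ← tsum_mul_left]
    have : durfeeTermShift q c 0 - durfeeTerm q (c + 1) 0 = 0 := by
      simp [durfeeTermShift, durfeeTerm]
    rw [this, zero_add]
    refine tsum_congr fun N => ?_
    have h1 := qPoch_ne_zero hq N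
    have h2 := one_sub_pow_ne_zero hq (Nat.succ_ne_zero N)
    have h3 := qPoch_ne_zero hq (N + c + 2)
    rw [durfeeTermShift, durfeeTerm, durfeeTerm, show N + 1 + (c + 1) = N + c + 2 by ring,
      show N + 1 + c + 1 = N + c + 2 by ring, show N + (c + 2) = N + c + 2 by ring, qPoch_succ N]
    rw [Nat.succ_eq_add_one] at h2
    field_simp
    ring
  rw [sT.tsum_sub s1] at hd
  have hT : ∑' N, durfeeTermShift q c N =
      ∑' N, durfeeTerm q c N + q ^ (c + 1) * ∑' N, durfeeTerm q (c + 1) N := by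
    rw [funext (durfeeTermShift_eq hq c), s0.tsum_add (s1.mul_left _), tsum_mul_left]
  rw [← hT]
  linear_combination hd

/-- The recurrence says that consecutive differences satisfy D_c = -q^(c+1) D_(c+1). The differences
are bounded, so iterating forces D_c = 0. -/
lemma tsum_durfeeTerm_succ (hq : ‖q‖ < 1) (c : ℕ) :
    ∑' N, durfeeTerm q c N = ∑' N, durfeeTerm q (c + 1) N := by
  obtain ⟨B, hB0, hB⟩ := exists_norm_durfeeTerm_le hq
  have hg := summable_geometric_of_lt_one (norm_nonneg q) hq
  obtain ⟨U, hU⟩ : ∃ U : ℕ → ℂ, U = fun c => ∑' N, durfeeTerm q c N := ⟨_, rfl⟩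
  have hUc (c : ℕ) : ∑' N, durfeeTerm q c N = U c := by rw [hU]
  have hM (c : ℕ) : ‖U c‖ ≤ ∑' N, B * ‖q‖ ^ N := by
    rw [← hUc]
    exact tsum_of_norm_bounded (hg.mul_left B).hasSum (hB c)
  set M := ∑' N, B * ‖q‖ ^ N
  have hstep (c : ℕ) : ‖U c - U (c + 1)‖ ≤ ‖q‖ * ‖U (c + 1) - U (c + 2)‖ := by
    have h := tsum_durfeeTerm_recurrence hq c
    simp only [hUc] at h
    rw [show U c - U (c + 1) = -q ^ (c + 1) * (U (c + 1) - U (c + 2)) by linear_combination h,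
      norm_mul, norm_neg, norm_pow]
    gcongr
    exact pow_le_of_le_one (norm_nonneg q) hq.le (Nat.succ_ne_zero c)
  have hiter (k : ℕ) : ‖U c - U (c + 1)‖ ≤ ‖q‖ ^ k * ‖U (c + k) - U (c + k + 1)‖ := by
    induction k with
    | zero => simp
    | succ k ih =>
      refine ih.trans ?_
      rw [pow_succ, mul_assoc]
      gcongr
      exact hstep (c + k)
  have hlim : Tendsto (fun k : ℕ => ‖q‖ ^ k * (M + M)) atTop (𝓝 0) := by
    simpa using (tendsto_pow_atTop_nhds_zero_of_lt_one (norm_nonneg q) hq).mul_const (M + M)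
  have h0 : ‖U c - U (c + 1)‖ ≤ 0 := ge_of_tendsto' hlim fun k => (hiter k).trans (by
    gcongr
    exact (norm_sub_le _ _).trans (add_le_add (hM _) (hM _)))
  rw [hUc, hUc]
  exact sub_eq_zero.1 (norm_le_zero_iff.1 h0)

/-- The sum does not depend on c, and as c → ∞ only the term N = 0 survives. -/
lemma tsum_durfeeTerm (hq : ‖q‖ < 1) (c : ℕ) : ∑' N, durfeeTerm q c N = (qInf q)⁻¹ := by
  obtain ⟨B, hB0, hB⟩ := exists_norm_durfeeTerm_le hq
  have hg := summable_geometric_of_lt_one (norm_nonneg q) hq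
  have hconst (k : ℕ) : ∑' N, durfeeTerm q (k + c) N = ∑' N, durfeeTerm q c N := by
    induction k with
    | zero => simp
    | succ k ih => rw [← ih, tsum_durfeeTerm_succ hq (k + c)]; congr! 3; ring
  obtain ⟨b, hb0, hb⟩ := exists_norm_qPoch_inv_le hq
  have hlim : Tendsto (fun k : ℕ => ∑' N, durfeeTerm q k N) atTop
      (𝓝 (∑' N, if N = 0 then (qInf q)⁻¹ else 0)) := by
    refine tendsto_tsum_of_dominated_convergence (hg.mul_left B) (fun N => ?_)
      (Eventually.of_forall fun n N => hB n N)
    rcases N with _ | N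
    · simpa [durfeeTerm] using (tendsto_qPoch hq).inv₀ (qInf_ne_zero hq)
    · rw [if_neg (Nat.succ_ne_zero N)]
      have hgeo : Tendsto (fun k : ℕ => b * b * ‖q‖ ^ k) atTop (𝓝 0) := by
        simpa using (tendsto_pow_atTop_nhds_zero_of_lt_one (norm_nonneg q) hq).const_mul (b * b)
      refine squeeze_zero_norm (fun k => ?_) hgeo
      rw [durfeeTerm, norm_mul, norm_mul, norm_pow]
      calc _ ≤ ‖q‖ ^ k * b * b := by
            have := pow_le_pow_of_le_one (norm_nonneg q) hq.le
              (show k ≤ (N + 1) ^ 2 + (N + 1) * k by nlinarith)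
            gcongr
            · exact hb _
            · exact hb _
        _ = _ := by ring
  rw [tsum_ite_eq] at hlim
  have h2 : Tendsto (fun k : ℕ => ∑' N, durfeeTerm q (k + c) N) atTop (𝓝 (qInf q)⁻¹) :=
    (tendsto_add_atTop_iff_nat c).2 hlim
  simp only [hconst] at h2
  exact tendsto_nhds_unique tendsto_const_nhds h2

lemma tsum_durfeeTermShift (hq : ‖q‖ < 1) (c : ℕ) :
    ∑' N, durfeeTermShift q c N = (1 + q ^ (c + 1)) * (qInf q)⁻¹ := by
  have s0 := summable_durfeeTerm hq c
  have s1 := summable_durfeeTerm hq (c + 1)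
  rw [funext (durfeeTermShift_eq hq c), s0.tsum_add (s1.mul_left _), tsum_mul_left,
    tsum_durfeeTerm hq, tsum_durfeeTerm hq]
  ring

end DurfeeSums

/-! ### Reducing the hypergeometric series to theta series -/

section HypergeometricSums

open Filter Topology

lemma hasSum_sum_antidiagonal {f : ℕ × ℕ → ℂ} {a : ℂ} (h : HasSum f a) :
    HasSum (fun n => ∑ x ∈ Finset.HasAntidiagonal.antidiagonal n, f x) a := by
  refine (Finset.HasAntidiagonal.sigmaAntidiagonalEquivProd.hasSum_iff.2 h).sigma fun n => ?_
  rw [← Finset.sum_coe_sort]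
  exact hasSum_fintype _

variable {p : ℂ}

/-- The finite triple product at z = 1, read as a Bailey pair. The indices n - j and n - j + (2j +
1) are those of a Durfee rectangle with N = n - j. -/
lemma qPoch_sq_div (hp0 : p ≠ 0) (hp : ‖p‖ < 1) (n : ℕ) :
    qPoch (p ^ 2) n ^ 2 / qPoch (p ^ 2) (2 * n + 1) =
      ∑ j ∈ Finset.range (n + 1), (-1) ^ j * p ^ (j * (j + 1)) * (2 * j + 1) *
        ((qPoch (p ^ 2) (n - j))⁻¹ * (qPoch (p ^ 2) (n - j + (2 * j + 1)))⁻¹) := by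
  have h := sum_tripleCoeff hp0 hp (w := fun j => 2 * (j : ℂ) + 1) (t := 2) (by simp)
    (by norm_num) (fun j => by push_cast; ring) n
  rw [show qPoch (p ^ 2) n ^ 2 = ∏ k ∈ Finset.range n,
      (1 - 2 * (p ^ 2) ^ (k + 1) + (p ^ 2) ^ (2 * (k + 1))) by
    rw [qPoch, ← Finset.prod_pow]
    exact Finset.prod_congr rfl fun k _ => by ring, ← h]
  refine Finset.sum_congr rfl fun j hj => ?_
  have hj : j ≤ n := by simpa [Nat.lt_succ_iff] using hj
  rw [tripleCoeff, show (n : ℤ) - j = ((n - j : ℕ) : ℤ) by lia,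
    show (n : ℤ) + 1 + j = ((n - j + (2 * j + 1) : ℕ) : ℤ) by lia, qPochInv_natCast,
    qPochInv_natCast, zpow_natCast,
    show (p : ℂ) ^ ((j : ℤ) * (j + 1)) = p ^ (j * (j + 1)) by
      rw [← zpow_natCast]; push_cast; rfl]
  ring

/-- Interchanging the order of summation after `qPoch_sq_div`. -/
lemma hasSum_qPoch_sq_div (hp0 : p ≠ 0) (hp : ‖p‖ < 1) (ε : ℕ) {g : ℕ → ℂ} {a : ℂ}
    (hg : ∀ j, ∑' N, (p ^ 2) ^ ((N + j) ^ 2 + ε * (N + j)) *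
      ((qPoch (p ^ 2) N)⁻¹ * (qPoch (p ^ 2) (N + (2 * j + 1)))⁻¹) = g j)
    (ha : HasSum (fun j : ℕ => (-1) ^ j * p ^ (j * (j + 1)) * (2 * j + 1) * g j) a) :
    HasSum (fun n : ℕ => (p ^ 2) ^ (n ^ 2 + ε * n) *
      (qPoch (p ^ 2) n ^ 2 / qPoch (p ^ 2) (2 * n + 1))) a := by
  have hq := norm_sq_lt_one hp
  obtain ⟨B, hB0, hB⟩ := exists_norm_qPoch_inv_le hq
  set f : ℕ × ℕ → ℂ := fun x => (-1) ^ x.1 * p ^ (x.1 * (x.1 + 1)) * (2 * x.1 + 1) *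
    ((p ^ 2) ^ ((x.2 + x.1) ^ 2 + ε * (x.2 + x.1)) *
      ((qPoch (p ^ 2) x.2)⁻¹ * (qPoch (p ^ 2) (x.2 + (2 * x.1 + 1)))⁻¹)) with hf
  have hfs : Summable f := by
    have h1 := (summable_succ_mul_geometric (norm_nonneg p) hp).mul_left 2
    have h2 := (summable_geometric_of_lt_one (norm_nonneg _) hq).mul_left (B * B)
    refine Summable.of_norm_bounded (h1.mul_of_nonneg h2 (fun j => by positivity)
      fun N => by positivity) fun ⟨j, N⟩ => ?_
    have e1 : ‖p‖ ^ (j * (j + 1)) ≤ ‖p‖ ^ j :=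
      pow_le_pow_of_le_one (norm_nonneg p) hp.le (Nat.le_mul_of_pos_right j (Nat.succ_pos j))
    have e2 : ‖p ^ 2‖ ^ ((N + j) ^ 2 + ε * (N + j)) ≤ ‖p ^ 2‖ ^ N :=
      pow_le_pow_of_le_one (norm_nonneg _) hq.le (by nlinarith [Nat.zero_le (ε * (N + j))])
    have e3 : ‖(2 * j + 1 : ℂ)‖ ≤ 2 * ((j : ℝ) + 1) := by
      have := Complex.norm_natCast (2 * j + 1)
      push_cast at this
      rw [this]; linarith
    simp only [hf, norm_mul]
    rw [norm_pow (-1 : ℂ), norm_neg, norm_one, one_pow, one_mul, norm_pow p, norm_pow (p ^ 2)]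
    calc _ ≤ ‖p‖ ^ j * (2 * ((j : ℝ) + 1)) * (‖p ^ 2‖ ^ N * (B * B)) := by
          gcongr
          exacts [hB _, hB _]
      _ = _ := by ring
  have hfib : ∑' x, f x = a := by
    rw [hfs.tsum_prod, ← ha.tsum_eq]
    refine tsum_congr fun j => ?_
    rw [← hg j, ← tsum_mul_left]
  -- The double series in (j, N) is regrouped along n = j + N.
  have := hasSum_sum_antidiagonal hfs.hasSum
  rw [hfib] at this
  refine this.congr_fun fun n => ?_
  rw [Finset.Nat.sum_antidiagonal_eq_sum_range_succ_mk, qPoch_sq_div hp0 hp, Finset.mul_sum]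
  refine Finset.sum_congr rfl fun j hj => ?_
  have hj : j ≤ n := by simpa [Nat.lt_succ_iff] using hj
  simp only [hf, Nat.sub_add_cancel hj]
  ring

/-- Since (N + j)² = N² + 2jN + j², the inner sum is the shifted Durfee series with c = 2j. -/
lemma hasSum_even_part (hp0 : p ≠ 0) (hp : ‖p‖ < 1) {a : ℂ}
    (ha : HasSum (fun j : ℕ => (-1) ^ j * (2 * j + 1) * p ^ (3 * j ^ 2 + j) *
      (1 + p ^ (4 * j + 2))) a) :
    HasSum (fun n : ℕ => (p ^ 2) ^ (n ^ 2) *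
      (qPoch (p ^ 2) n ^ 2 / qPoch (p ^ 2) (2 * n + 1))) (a * (qInf (p ^ 2))⁻¹) := by
  have hq := norm_sq_lt_one hp
  have h := hasSum_qPoch_sq_div hp0 hp 0 (a := a * (qInf (p ^ 2))⁻¹)
    (g := fun j => (p ^ 2) ^ (j ^ 2) * ((1 + (p ^ 2) ^ (2 * j + 1)) * (qInf (p ^ 2))⁻¹))
    (fun j => ?_) ?_
  · simpa using h
  · rw [← tsum_durfeeTermShift hq, ← tsum_mul_left]
    refine tsum_congr fun N => ?_
    rw [durfeeTermShift, ← add_assoc]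
    ring
  · refine (ha.mul_right (qInf (p ^ 2))⁻¹).congr_fun fun j => ?_
    ring

/-- Since (N + j)² + N + j = N² + (2j + 1)N + j² + j, the inner sum is the plain Durfee series with
c = 2j + 1. -/
lemma hasSum_odd_part (hp0 : p ≠ 0) (hp : ‖p‖ < 1) {a : ℂ}
    (ha : HasSum (fun j : ℕ => (-1) ^ j * (2 * j + 1) * p ^ (3 * j * (j + 1))) a) :
    HasSum (fun n : ℕ => (p ^ 2) ^ (n ^ 2 + n) *
      (qPoch (p ^ 2) n ^ 2 / qPoch (p ^ 2) (2 * n + 1))) (a * (qInf (p ^ 2))⁻¹) := by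
  have hq := norm_sq_lt_one hp
  have h := hasSum_qPoch_sq_div hp0 hp 1 (a := a * (qInf (p ^ 2))⁻¹)
    (g := fun j => (p ^ 2) ^ (j ^ 2 + j) * (qInf (p ^ 2))⁻¹) (fun j => ?_) ?_
  · simpa using h
  · rw [← tsum_durfeeTerm hq (2 * j + 1), ← tsum_mul_left]
    refine tsum_congr fun N => ?_
    rw [durfeeTerm]
    ring
  · refine (ha.mul_right (qInf (p ^ 2))⁻¹).congr_fun fun j => ?_
    ring

end HypergeometricSums

/-! ### Theta series over the integers and the pentagonal number theorem -/

section ThetaSeries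

open Filter Topology

variable {p : ℂ}

lemma summable_int_of_nat_abs {g : ℕ → ℝ} (hg : Summable g) : Summable fun k : ℤ => g k.natAbs := by
  refine Summable.of_nat_of_neg (by simpa using hg) (by simpa using hg)

lemma norm_zpow_le_natAbs (hp0 : p ≠ 0) (hp : ‖p‖ < 1) {m e : ℤ} (h : |m| - 1 ≤ e) :
    ‖p ^ e‖ ≤ ‖p‖⁻¹ * ‖p‖ ^ m.natAbs := by
  have hn : ‖p‖ ≠ 0 := norm_ne_zero_iff.2 hp0
  rw [norm_zpow, ← zpow_natCast, ← zpow_neg_one, ← zpow_add₀ hn]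
  exact zpow_le_zpow_right_of_le_one₀ (norm_pos_iff.2 hp0) hp.le
    (by rw [Int.abs_eq_natAbs] at h; lia)

lemma norm_neg_one_zpow (m : ℤ) : ‖(-1 : ℂ) ^ m‖ = 1 := by simp

/-- The slack of 1 in the exponent bound is needed for k(k - 1), which vanishes at k = 1. -/
lemma summable_norm_theta (hp0 : p ≠ 0) (hp : ‖p‖ < 1) {w : ℤ → ℂ} {K : ℝ}
    (hw : ∀ m : ℤ, ‖w m‖ ≤ K * (m.natAbs + 1)) {e : ℤ → ℤ} (he : ∀ m, |m| - 1 ≤ e m) :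
    Summable fun m : ℤ => ‖(-1) ^ m * w m * p ^ e m‖ := by
  have hs := (summable_int_of_nat_abs
    (summable_succ_mul_geometric (norm_nonneg p) hp)).mul_left (K * ‖p‖⁻¹)
  refine Summable.of_nonneg_of_le (fun _ => norm_nonneg _) (fun m => ?_) hs
  rw [norm_mul, norm_mul, norm_neg_one_zpow, one_mul]
  calc ‖w m‖ * ‖p ^ e m‖ ≤ (K * (m.natAbs + 1)) * (‖p‖⁻¹ * ‖p‖ ^ m.natAbs) :=
        mul_le_mul (hw m) (norm_zpow_le_natAbs hp0 hp (he m)) (norm_nonneg _)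
          ((norm_nonneg _).trans (hw m))
    _ = _ := by ring

lemma hasSum_int_of_nat {f : ℤ → ℂ} {a : ℂ} (hf : Summable f)
    (h : HasSum (fun n : ℕ => f n + f (-(n + 1))) a) : HasSum f a := by
  have := hf.hasSum.nat_add_neg_add_one.unique h
  exact this ▸ hf.hasSum

lemma tsum_int_eq_zero_of_reflect {f : ℤ → ℂ} (c : ℤ) (h : ∀ m, f (c - m) = -f m) :
    ∑' m, f m = 0 := by
  have h1 : ∑' m, f (c - m) = ∑' m, f m := (Equiv.subLeft c).tsum_eq f
  simp only [h, tsum_neg] at h1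
  linear_combination (-1 / 2 : ℂ) * h1

lemma tsum_int_mod_three {f : ℤ → ℂ} (hf : Summable f) :
    ∑' k, f k = ∑' m, f (3 * m) + ∑' m, f (3 * m + 1) + ∑' m, f (3 * m + 2) := by
  have h1 := (Int.divModEquiv 3).symm.summable_iff.2 hf
  have h2 := (Equiv.prodComm (Fin 3) ℤ).summable_iff.2 h1
  rw [← (Int.divModEquiv 3).symm.tsum_eq, ← (Equiv.prodComm (Fin 3) ℤ).tsum_eq]
  have h3 := h2.tsum_prod
  simp only [Function.comp_def] at h3
  rw [h3, tsum_fintype, Fin.sum_univ_three]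
  simp [Int.divModEquiv, mul_comm]

lemma neg_one_zpow_mul_self (m : ℤ) : ((-1 : ℂ) ^ m) * (-1) ^ m = 1 := by
  rw [← zpow_add₀ (by norm_num)]
  exact Even.neg_one_zpow ⟨m, rfl⟩

lemma neg_one_zpow_neg (m : ℤ) : (-1 : ℂ) ^ (-m) = (-1) ^ m := by
  rw [zpow_neg]
  exact inv_eq_of_mul_eq_one_left (neg_one_zpow_mul_self m)

lemma neg_one_zpow_congr {m n : ℤ} (h : Even (m - n)) : (-1 : ℂ) ^ m = (-1) ^ n := by
  rw [show m = m - n + n by ring, zpow_add₀ (by norm_num), h.neg_one_zpow, one_mul]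

lemma neg_one_zpow_congr_odd {m n : ℤ} (h : Odd (m - n)) : (-1 : ℂ) ^ m = -(-1) ^ n := by
  rw [show m = m - n + n by ring, zpow_add₀ (by norm_num), h.neg_one_zpow, neg_one_mul]

lemma summable_theta_cubeRoot (hp0 : p ≠ 0) (hp : ‖p‖ < 1) {ω : ℂ} (hω : ‖ω‖ = 1) {e : ℤ → ℤ}
    (he : ∀ m, |m| - 1 ≤ e m) : Summable fun k : ℤ => ‖(-1) ^ k * ω ^ k * p ^ e k‖ := by
  refine summable_norm_theta hp0 hp (K := 1) (fun m => ?_) he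
  rw [norm_zpow, hω, one_zpow]
  simp

lemma summable_theta_one (hp0 : p ≠ 0) (hp : ‖p‖ < 1) {e : ℤ → ℤ}
    (he : ∀ m, |m| - 1 ≤ e m) : Summable fun k : ℤ => ‖(-1) ^ k * p ^ e k‖ := by
  simpa using summable_theta_cubeRoot hp0 hp (ω := 1) (by simp) he

lemma summable_theta_linear (hp0 : p ≠ 0) (hp : ‖p‖ < 1) (a b : ℤ) {e : ℤ → ℤ}
    (he : ∀ m, |m| - 1 ≤ e m) :
    Summable fun k : ℤ => ‖(-1) ^ k * (a * k + b : ℂ) * p ^ e k‖ := by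
  refine summable_norm_theta hp0 hp (K := ‖(a : ℂ)‖ + ‖(b : ℂ)‖) (fun m => ?_) he
  refine (norm_add_le _ _).trans ?_
  have : ‖(m : ℂ)‖ = m.natAbs := by
    rw [Complex.norm_intCast, Nat.cast_natAbs, Int.cast_abs]
  rw [norm_mul, this]
  have h1 := norm_nonneg (a : ℂ)
  have h2 : 0 ≤ ‖(b : ℂ)‖ * (m.natAbs : ℝ) := by positivity
  nlinarith

lemma abs_sub_one_le_mul_sub_one (k : ℤ) : |k| - 1 ≤ k * (k - 1) := by
  rcases abs_cases k with ⟨h, _⟩ | ⟨h, _⟩ <;> rw [h] <;> nlinarith [sq_nonneg (k - 1)]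

lemma abs_sub_one_le_pentagonal (k : ℤ) : |k| - 1 ≤ 3 * k ^ 2 + k := by
  rcases abs_cases k with ⟨h, _⟩ | ⟨h, _⟩ <;> rw [h] <;> nlinarith [sq_nonneg k]

lemma abs_sub_one_le_three_mul (k : ℤ) : |k| - 1 ≤ 3 * (k * (k - 1)) := by
  rcases abs_cases k with ⟨h, _⟩ | ⟨h, _⟩ <;> rw [h] <;> nlinarith [sq_nonneg (k - 1)]

lemma norm_eq_one_of_cubeRoot {ω : ℂ} (hω : ω ^ 2 + ω + 1 = 0) : ‖ω‖ = 1 := by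
  have hω3 : ω ^ 3 = 1 := by linear_combination (ω - 1) * hω
  have : ‖ω‖ ^ 3 = 1 := by rw [← norm_pow, hω3, norm_one]
  exact (pow_eq_one_iff_of_nonneg (norm_nonneg _) three_ne_zero).1 this

lemma hasSum_theta_cubeRoot (hp0 : p ≠ 0) (hp : ‖p‖ < 1) {ω : ℂ} (hω : ω ^ 2 + ω + 1 = 0) :
    HasSum (fun k : ℤ => (-1) ^ k * ω ^ k * p ^ (k * (k - 1))) ((1 - ω) * qInf (p ^ 6)) := by
  have hs := (summable_theta_cubeRoot hp0 hp (norm_eq_one_of_cubeRoot hω)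
    abs_sub_one_le_mul_sub_one).of_norm
  have hω0 : ω ≠ 0 := by rintro rfl; norm_num at hω
  have hinv : ω⁻¹ = ω ^ 2 := by
    rw [inv_eq_iff_eq_inv, eq_comm, inv_eq_iff_eq_inv, eq_comm]
    exact inv_eq_of_mul_eq_one_left (by linear_combination (ω - 1) * hω)
  rw [← (Equiv.neg ℤ).hasSum_iff]
  refine hasSum_int_of_nat ((Equiv.neg ℤ).summable_iff.2 hs) ?_
  refine (hasSum_tripleProduct_cubeRoot hp0 hp hω).congr_fun fun n => ?_
  simp only [Function.comp_apply, Equiv.neg_apply, neg_neg]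
  rw [neg_one_zpow_neg, zpow_natCast, zpow_neg, zpow_natCast, ← inv_pow, hinv, ← pow_mul,
    show -(n : ℤ) * (-n - 1) = ((n * (n + 1) : ℕ) : ℤ) by push_cast; ring,
    show ((n : ℤ) + 1) * (n + 1 - 1) = ((n * (n + 1) : ℕ) : ℤ) by push_cast; ring, zpow_natCast,
    show ((n : ℤ) + 1) = ((n + 1 : ℕ) : ℤ) by push_cast; ring, zpow_natCast, zpow_natCast]
  ring

lemma tsum_theta_eq_zero (a : ℤ) :
    ∑' k : ℤ, (-1) ^ k * p ^ (a * (k * (k - 1))) = 0 := by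
  refine tsum_int_eq_zero_of_reflect 1 fun m => ?_
  rw [neg_one_zpow_congr_odd (m := 1 - m) (n := m) ⟨-m, by ring⟩]
  rw [show a * ((1 - m) * (1 - m - 1)) = a * (m * (m - 1)) by ring]
  ring

/-- Pairing k = -n with k = n + 1 gives weights -(2n + 1), hence Jacobi's cube identity at p³. -/
lemma tsum_mul_theta (hp0 : p ≠ 0) (hp : ‖p‖ < 1) :
    ∑' k : ℤ, (-1) ^ k * (k : ℂ) * p ^ (3 * (k * (k - 1))) = -qInf (p ^ 6) ^ 3 := by
  have hs : Summable fun k : ℤ => (-1) ^ k * (k : ℂ) * p ^ (3 * (k * (k - 1))) := by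
    simpa using (summable_theta_linear hp0 hp 1 0 abs_sub_one_le_three_mul).of_norm
  have h3 : ‖p ^ 3‖ < 1 := by
    rw [norm_pow]; exact pow_lt_one₀ (norm_nonneg p) hp (by norm_num)
  refine HasSum.tsum_eq ?_
  rw [← (Equiv.neg ℤ).hasSum_iff]
  refine hasSum_int_of_nat ((Equiv.neg ℤ).summable_iff.2 hs) ?_
  have h := (hasSum_qInf_cube (pow_ne_zero 3 hp0) h3).neg
  rw [← pow_mul] at h
  refine h.congr_fun fun n => ?_
  simp only [Function.comp_apply, Equiv.neg_apply, neg_neg]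
  rw [neg_one_zpow_neg, zpow_natCast,
    show 3 * (-(n : ℤ) * (-n - 1)) = ((3 * (n * (n + 1)) : ℕ) : ℤ) by push_cast; ring,
    show 3 * (((n : ℤ) + 1) * (n + 1 - 1)) = ((3 * (n * (n + 1)) : ℕ) : ℤ) by push_cast; ring,
    zpow_natCast, show ((n : ℤ) + 1) = ((n + 1 : ℕ) : ℤ) by push_cast; ring, zpow_natCast,
    pow_mul p 3]
  push_cast
  ring

lemma exists_cubeRoot : ∃ ω : ℂ, ω ^ 2 + ω + 1 = 0 := by
  obtain ⟨s, hs⟩ := IsAlgClosed.exists_pow_nat_eq (-3 : ℂ) two_pos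
  exact ⟨(-1 + s) / 2, by linear_combination hs / 4⟩

lemma tsum_pentagonal_neg : ∑' m : ℤ, (-1) ^ m * p ^ (3 * m ^ 2 - m) =
    ∑' m : ℤ, (-1) ^ m * p ^ (3 * m ^ 2 + m) := by
  rw [← (Equiv.neg ℤ).tsum_eq]
  refine tsum_congr fun m => ?_
  rw [Equiv.neg_apply, neg_one_zpow_neg]
  congr 2; ring

/-- Euler's pentagonal number theorem. -/
lemma tsum_pentagonal (hp0 : p ≠ 0) (hp : ‖p‖ < 1) :
    ∑' m : ℤ, (-1) ^ m * p ^ (3 * m ^ 2 + m) = qInf (p ^ 2) := by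
  -- With p = s³, the theta series at ω in the variable s is dissected modulo 3. Classes 0 and 1
  -- give 1 and -ω times the pentagonal series and class 2 cancels by reflection, so the factor 1 -
  -- ω appears on both sides.
  obtain ⟨s, rfl⟩ := IsAlgClosed.exists_pow_nat_eq p three_pos
  have hs0 : s ≠ 0 := by rintro rfl; simp at hp0
  have hs : ‖s‖ < 1 := by
    rw [norm_pow] at hp
    exact lt_of_not_ge fun h => hp.not_ge (one_le_pow₀ h)
  obtain ⟨ω, hω⟩ := exists_cubeRoot
  have hω0 : ω ≠ 0 := by rintro rfl; norm_num at hω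
  have hω3 : ω ^ 3 = 1 := by linear_combination (ω - 1) * hω
  have hω1 : 1 - ω ≠ 0 := by
    intro h
    rw [show ω = 1 by linear_combination -h] at hω
    norm_num at hω
  have hω3z (m : ℤ) : ω ^ (3 * m) = 1 := by
    rw [zpow_mul]; norm_cast; rw [hω3]; simp
  have h := hasSum_theta_cubeRoot hs0 hs hω
  have h2 := tsum_int_mod_three h.summable
  have hz : ∑' m : ℤ, (-1) ^ (3 * m + 2) * ω ^ (3 * m + 2) * s ^ ((3 * m + 2) * (3 * m + 2 - 1))
      = 0 := by
    refine tsum_int_eq_zero_of_reflect (-1) fun m => ?_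
    rw [neg_one_zpow_congr_odd (m := 3 * (-1 - m) + 2) (n := 3 * m + 2) ⟨-3 * m - 2, by ring⟩,
      zpow_add₀ hω0, zpow_add₀ hω0, hω3z, hω3z,
      show (3 * (-1 - m) + 2) * (3 * (-1 - m) + 2 - 1) = (3 * m + 2) * (3 * m + 2 - 1) by ring]
    ring
  have h0 : ∑' m : ℤ, (-1) ^ (3 * m) * ω ^ (3 * m) * s ^ (3 * m * (3 * m - 1)) =
      ∑' m : ℤ, (-1) ^ m * (s ^ 3) ^ (3 * m ^ 2 - m) := by
    refine tsum_congr fun m => ?_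
    rw [neg_one_zpow_congr (m := 3 * m) (n := m) ⟨m, by ring⟩, hω3z, ← zpow_natCast s 3, ← zpow_mul]
    rw [mul_one]
    congr 2; push_cast; ring
  have h1 : ∑' m : ℤ, (-1) ^ (3 * m + 1) * ω ^ (3 * m + 1) * s ^ ((3 * m + 1) * (3 * m + 1 - 1)) =
      -ω * ∑' m : ℤ, (-1) ^ m * (s ^ 3) ^ (3 * m ^ 2 + m) := by
    rw [← tsum_mul_left]
    refine tsum_congr fun m => ?_
    rw [neg_one_zpow_congr_odd (m := 3 * m + 1) (n := m) ⟨m, by ring⟩, zpow_add₀ hω0, hω3z,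
      ← zpow_natCast s 3, ← zpow_mul, zpow_one,
      show (3 * m + 1) * (3 * m + 1 - 1) = ((3 : ℕ) : ℤ) * (3 * m ^ 2 + m) by push_cast; ring]
    ring
  rw [h0, h1, hz, h.tsum_eq, tsum_pentagonal_neg] at h2
  rw [← pow_mul]
  refine mul_left_cancel₀ hω1 ?_
  linear_combination -h2

/-- The sum of `hasSum_even_part` as a sum over all integers. -/
lemma hasSum_even_part_theta (hp0 : p ≠ 0) (hp : ‖p‖ < 1) :
    HasSum (fun j : ℕ => (-1) ^ j * (2 * j + 1) * p ^ (3 * j ^ 2 + j) * (1 + p ^ (4 * j + 2)))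
      (∑' m : ℤ, (-1) ^ m * (2 * m + 1 : ℂ) * p ^ (3 * m ^ 2 + m)) := by
  have hs := (summable_theta_linear hp0 hp 2 1 abs_sub_one_le_pentagonal).of_norm
  push_cast at hs
  refine hs.hasSum.nat_add_neg_add_one.congr_fun fun j => ?_
  rw [neg_one_zpow_congr_odd (m := -((j : ℤ) + 1)) (n := j) ⟨-j - 1, by ring⟩, zpow_natCast,
    show 3 * (j : ℤ) ^ 2 + j = ((3 * j ^ 2 + j : ℕ) : ℤ) by push_cast; ring,
    show 3 * (-((j : ℤ) + 1)) ^ 2 + -((j : ℤ) + 1) = ((3 * j ^ 2 + j + (4 * j + 2) : ℕ) : ℤ) by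
      push_cast; ring, zpow_natCast, zpow_natCast]
  push_cast
  ring

lemma hasSum_odd_part_theta (hp0 : p ≠ 0) (hp : ‖p‖ < 1) :
    HasSum (fun j : ℕ => (-1) ^ j * (2 * j + 1) * p ^ (3 * j * (j + 1))) (qInf (p ^ 6) ^ 3) := by
  have h3 : ‖p ^ 3‖ < 1 := by
    rw [norm_pow]; exact pow_lt_one₀ (norm_nonneg p) hp (by norm_num)
  have h := hasSum_qInf_cube (pow_ne_zero 3 hp0) h3
  rw [← pow_mul] at h
  refine h.congr_fun fun n => ?_
  ring

end ThetaSeries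

/-! ### Borwein cubic theta functions by cubing a theta series -/

section CubicTheta

open Filter Topology

variable {p : ℂ}

/-- The exponent of the lattice series `∑ p ^ (2 (x² + x y + y²))`. -/
def hexForm (x : ℤ × ℤ) : ℤ := 2 * (x.1 ^ 2 + x.1 * x.2 + x.2 ^ 2)

/-- The exponent of the shifted lattice series `∑ p ^ (2 (x² + x y + y² + x + y))`. -/
def hexFormShift (x : ℤ × ℤ) : ℤ := 2 * (x.1 ^ 2 + x.1 * x.2 + x.2 ^ 2 + x.1 + x.2)

lemma natAbs_add_natAbs_le_hexForm (x : ℤ × ℤ) :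
    ((x.1.natAbs : ℤ) + x.2.natAbs) ≤ hexForm x := by
  have h1 := Int.natAbs_le_self_sq x.1
  have h2 := Int.natAbs_le_self_sq x.2
  unfold hexForm
  nlinarith [sq_nonneg (x.1 + x.2)]

lemma natAbs_add_natAbs_le_hexFormShift (x : ℤ × ℤ) :
    ((x.1.natAbs : ℤ) + x.2.natAbs) ≤ hexFormShift x + 1 := by
  have h1 := Int.natAbs_le_self_sq x.1
  have h2 := Int.natAbs_le_self_sq x.2
  unfold hexFormShift
  nlinarith [sq_nonneg (x.1 + x.2 + 1)]

lemma summable_zpow_lattice (hp0 : p ≠ 0) (hp : ‖p‖ < 1) {e : ℤ × ℤ → ℤ}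
    (he : ∀ x, ((x.1.natAbs : ℤ) + x.2.natAbs) ≤ e x + 1) : Summable fun x => p ^ e x := by
  have hg := summable_int_of_nat_abs (summable_geometric_of_lt_one (norm_nonneg p) hp)
  have h := (hg.mul_of_nonneg hg (fun _ => by positivity) fun _ => by positivity).mul_left ‖p‖⁻¹
  refine Summable.of_norm_bounded h fun x => ?_
  have hn : ‖p‖ ≠ 0 := norm_ne_zero_iff.2 hp0
  rw [norm_zpow, ← pow_add, ← zpow_natCast, ← zpow_neg_one, ← zpow_add₀ hn]
  exact zpow_le_zpow_right_of_le_one₀ (norm_pos_iff.2 hp0) hp.le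
    (by have := he x; lia)

lemma summable_hexForm (hp0 : p ≠ 0) (hp : ‖p‖ < 1) : Summable fun x => p ^ hexForm x :=
  summable_zpow_lattice hp0 hp fun x => (natAbs_add_natAbs_le_hexForm x).trans (by lia)

lemma summable_hexFormShift (hp0 : p ≠ 0) (hp : ‖p‖ < 1) : Summable fun x => p ^ hexFormShift x :=
  summable_zpow_lattice hp0 hp natAbs_add_natAbs_le_hexFormShift

/-- The terms of the theta series `∑ (-1)^k p ^ (k (k - 1))`. -/
noncomputable def thetaTerm (p : ℂ) (k : ℤ) : ℂ := (-1) ^ k * p ^ (k * (k - 1))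

lemma thetaTerm_mul_mul (hp0 : p ≠ 0) (a b c : ℤ) :
    thetaTerm p a * thetaTerm p b * thetaTerm p c =
      (-1) ^ (a + b + c) * p ^ (a * (a - 1) + b * (b - 1) + c * (c - 1)) := by
  rw [thetaTerm, thetaTerm, thetaTerm, zpow_add₀ hp0, zpow_add₀ hp0, zpow_add₀ (by norm_num),
    zpow_add₀ (by norm_num)]
  ring

/-- The coefficients of the cube of the theta series. -/
noncomputable def thetaCubeCoeff (p : ℂ) (k : ℤ) : ℂ :=
  ∑' x : ℤ × ℤ, thetaTerm p x.1 * thetaTerm p x.2 * thetaTerm p (k - x.1 - x.2)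

lemma thetaCubeCoeff_eq (hp0 : p ≠ 0) {k s d : ℤ} {e : ℤ × ℤ → ℤ} (u : ℤ × ℤ ≃ ℤ × ℤ)
    (h : ∀ x, (u x).1 * ((u x).1 - 1) + (u x).2 * ((u x).2 - 1) +
      (k - (u x).1 - (u x).2) * (k - (u x).1 - (u x).2 - 1) = d + e x) (hs : Even (k - s)) :
    thetaCubeCoeff p k = (-1) ^ s * p ^ d * ∑' x, p ^ e x := by
  rw [thetaCubeCoeff, ← u.tsum_eq, ← tsum_mul_left]
  refine tsum_congr fun x => ?_
  rw [thetaTerm_mul_mul hp0, h, zpow_add₀ hp0,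
    show (u x).1 + (u x).2 + (k - (u x).1 - (u x).2) = k by ring, neg_one_zpow_congr hs]
  ring

/-- Centring the three indices at their mean m cancels the linear terms and leaves u² + v² + (u +
v)². In the other two residue classes the mean is not an integer, which produces the shifted form.
-/
lemma thetaCubeCoeff_three_mul (hp0 : p ≠ 0) (m : ℤ) :
    thetaCubeCoeff p (3 * m) = (-1) ^ m * p ^ (3 * (m * (m - 1))) * ∑' x, p ^ hexForm x := by
  refine thetaCubeCoeff_eq hp0 ((Equiv.addRight m).prodCongr (Equiv.addRight m)) (fun x => ?_)
    ⟨m, by ring⟩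
  simp [hexForm]; ring

lemma thetaCubeCoeff_three_mul_add_one (hp0 : p ≠ 0) (m : ℤ) :
    thetaCubeCoeff p (3 * m + 1) =
      -((-1) ^ m * p ^ (3 * m ^ 2 - m) * ∑' x, p ^ hexFormShift x) := by
  rw [thetaCubeCoeff_eq hp0 (s := m + 1) (d := 3 * m ^ 2 - m) (e := hexFormShift)
    (((Equiv.neg ℤ).trans (Equiv.addRight m)).prodCongr ((Equiv.neg ℤ).trans (Equiv.addRight m)))
    (fun x => ?_) ⟨m, by ring⟩, zpow_add_one₀ (by norm_num)]
  · ring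
  · simp [hexFormShift]; ring

lemma thetaCubeCoeff_three_mul_add_two (hp0 : p ≠ 0) (m : ℤ) :
    thetaCubeCoeff p (3 * m + 2) =
      (-1) ^ m * p ^ (3 * m ^ 2 + m) * ∑' x, p ^ hexFormShift x := by
  refine thetaCubeCoeff_eq hp0 ((Equiv.addRight (m + 1)).prodCongr (Equiv.addRight (m + 1)))
    (fun x => ?_) ⟨m + 1, by ring⟩
  simp [hexFormShift]; ring

/-- Reindexing triples of integers by their sum. -/
def sumTripleEquiv : ℤ × ℤ × ℤ ≃ ℤ × ℤ × ℤ where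
  toFun x := (x.1 - x.2.1 - x.2.2, x.2)
  invFun x := (x.1 + x.2.1 + x.2.2, x.2)
  left_inv x := Prod.ext (by dsimp only; ring) rfl
  right_inv x := Prod.ext (by dsimp only; ring) rfl

/-- The cube of a theta series with weights, dissected modulo three. -/
lemma tsum_thetaTerm_cube (hp0 : p ≠ 0) {f : ℤ → ℂ}
    (hs : Summable fun x : ℤ × ℤ × ℤ =>
      f (x.1 + x.2.1 + x.2.2) * (thetaTerm p x.2.1 * thetaTerm p x.2.2 * thetaTerm p x.1)) :
    ∑' x : ℤ × ℤ × ℤ,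
      f (x.1 + x.2.1 + x.2.2) * (thetaTerm p x.2.1 * thetaTerm p x.2.2 * thetaTerm p x.1) =
    (∑' x, p ^ hexForm x) * (∑' m : ℤ, (-1) ^ m * f (3 * m) * p ^ (3 * (m * (m - 1)))) -
    (∑' x, p ^ hexFormShift x) * (∑' m : ℤ, (-1) ^ m * f (3 * m + 1) * p ^ (3 * m ^ 2 - m)) +
    (∑' x, p ^ hexFormShift x) * (∑' m : ℤ, (-1) ^ m * f (3 * m + 2) * p ^ (3 * m ^ 2 + m)) := by
  have hs' := sumTripleEquiv.summable_iff.2 hs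
  have hsimp : ((fun x : ℤ × ℤ × ℤ => f (x.1 + x.2.1 + x.2.2) *
      (thetaTerm p x.2.1 * thetaTerm p x.2.2 * thetaTerm p x.1)) ∘ sumTripleEquiv) =
      fun x => f x.1 * (thetaTerm p x.2.1 * thetaTerm p x.2.2 *
        thetaTerm p (x.1 - x.2.1 - x.2.2)) := by
    ext x
    have : x.1 - x.2.1 - x.2.2 + x.2.1 + x.2.2 = x.1 := by ring
    simp [sumTripleEquiv, this]
  have hcoe := sumTripleEquiv.tsum_eq (fun x : ℤ × ℤ × ℤ => f (x.1 + x.2.1 + x.2.2) *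
      (thetaTerm p x.2.1 * thetaTerm p x.2.2 * thetaTerm p x.1))
  rw [← hcoe]
  change ∑' c, ((fun x : ℤ × ℤ × ℤ => f (x.1 + x.2.1 + x.2.2) *
      (thetaTerm p x.2.1 * thetaTerm p x.2.2 * thetaTerm p x.1)) ∘ sumTripleEquiv) c = _
  rw [hsimp] at hs' ⊢
  have hk := hs'.prod
  rw [hs'.tsum_prod]
  simp only [tsum_mul_left] at hk ⊢
  change ∑' k, f k * thetaCubeCoeff p k = _
  change Summable (fun k => f k * thetaCubeCoeff p k) at hk
  rw [tsum_int_mod_three hk]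
  simp only [thetaCubeCoeff_three_mul hp0, thetaCubeCoeff_three_mul_add_one hp0,
    thetaCubeCoeff_three_mul_add_two hp0]
  rw [← tsum_mul_left, ← tsum_mul_left, ← tsum_mul_left, sub_eq_add_neg, ← tsum_neg]
  congr 1
  · congr 1
    · exact tsum_congr fun m => by ring
    · exact tsum_congr fun m => by ring
  · exact tsum_congr fun m => by ring

lemma summable_triple {f g h : ℤ → ℂ} (hf : Summable fun k => ‖f k‖) (hg : Summable fun k => ‖g k‖)
    (hh : Summable fun k => ‖h k‖) :
    Summable fun x : ℤ × ℤ × ℤ => f x.1 * (g x.2.1 * h x.2.2) := by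
  have h1 := hg.mul_norm hh
  exact (hf.mul_norm h1).of_norm

lemma tsum_triple {f g h : ℤ → ℂ} (hf : Summable fun k => ‖f k‖) (hg : Summable fun k => ‖g k‖)
    (hh : Summable fun k => ‖h k‖) :
    ∑' x : ℤ × ℤ × ℤ, f x.1 * (g x.2.1 * h x.2.2) = (∑' k, f k) * ((∑' k, g k) * ∑' k, h k) := by
  have h1 := hg.mul_norm hh
  rw [tsum_mul_tsum_of_summable_norm hg hh, tsum_mul_tsum_of_summable_norm hf h1]

/-- The Borwein cubic theta function `c` as an eta quotient. -/
lemma tsum_hexFormShift_mul (hp0 : p ≠ 0) (hp : ‖p‖ < 1) :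
    (∑' x, p ^ hexFormShift x) * qInf (p ^ 2) = 3 * qInf (p ^ 6) ^ 3 := by
  obtain ⟨ω, hω⟩ := exists_cubeRoot
  have hω0 : ω ≠ 0 := by rintro rfl; norm_num at hω
  have hω3 : ω ^ 3 = 1 := by linear_combination (ω - 1) * hω
  have hω3z (m : ℤ) : ω ^ (3 * m) = 1 := by
    rw [zpow_mul]; norm_cast; rw [hω3]; simp
  have hn := norm_eq_one_of_cubeRoot hω
  have hth := hasSum_theta_cubeRoot hp0 hp hω
  have hsn := summable_theta_cubeRoot hp0 hp hn abs_sub_one_le_mul_sub_one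
  obtain ⟨g, hg⟩ : ∃ g : ℤ → ℂ, g = fun k => (-1) ^ k * ω ^ k * p ^ (k * (k - 1)) := ⟨_, rfl⟩
  have hgk (k : ℤ) : g k = (-1) ^ k * ω ^ k * p ^ (k * (k - 1)) := by rw [hg]
  simp only [← hgk] at hth hsn
  have hfun : (fun x : ℤ × ℤ × ℤ => ω ^ (x.1 + x.2.1 + x.2.2) *
      (thetaTerm p x.2.1 * thetaTerm p x.2.2 * thetaTerm p x.1)) = fun x =>
      g x.1 * (g x.2.1 * g x.2.2) := by
    ext x
    simp only [thetaTerm, hgk]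
    rw [zpow_add₀ hω0, zpow_add₀ hω0]
    ring
  -- The weight ω^k makes the left side θ(ω)³. The A-term vanishes by reflection, and (1 - ω)³ =
  -- 3(ω² - ω) supplies the factor 3.
  have h := tsum_thetaTerm_cube hp0 (f := fun k => ω ^ k)
    (by rw [hfun]; exact summable_triple hsn hsn hsn)
  rw [hfun, tsum_triple hsn hsn hsn, hth.tsum_eq] at h
  simp only [zpow_add₀ hω0, hω3z, mul_one, one_mul, zpow_one] at h
  rw [tsum_theta_eq_zero] at h
  have e1 : ∑' m : ℤ, (-1) ^ m * ω * p ^ (3 * m ^ 2 - m) = ω * qInf (p ^ 2) := by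
    rw [← tsum_pentagonal hp0 hp, ← tsum_pentagonal_neg, ← tsum_mul_left]
    exact tsum_congr fun m => by ring
  have e2 : ∑' m : ℤ, (-1) ^ m * ω ^ (2 : ℤ) * p ^ (3 * m ^ 2 + m) = ω ^ 2 * qInf (p ^ 2) := by
    rw [← tsum_pentagonal hp0 hp, ← tsum_mul_left]
    exact tsum_congr fun m => by rw [zpow_ofNat]; ring
  rw [e1, e2] at h
  have hne : ω ^ 2 - ω ≠ 0 := by
    intro h0
    have : ω = -1 / 2 := by linear_combination (hω - h0) / 2
    rw [this] at hω
    norm_num at hω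
  refine mul_left_cancel₀ hne ?_
  linear_combination -h - (qInf (p ^ 6) ^ 3) * (ω - 1) * hω

/-- The relation between the two Borwein cubic theta functions. -/
lemma tsum_hexForm_relation (hp0 : p ≠ 0) (hp : ‖p‖ < 1) :
    3 * (∑' x, p ^ hexForm x) * qInf (p ^ 6) ^ 3 = (∑' x, p ^ hexFormShift x) *
      ∑' m : ℤ, (-1) ^ m * (6 * m + 1 : ℂ) * p ^ (3 * m ^ 2 + m) := by
  have s0 : Summable fun k => ‖thetaTerm p k‖ :=
    summable_theta_one hp0 hp abs_sub_one_le_mul_sub_one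
  have s1 : Summable fun k : ℤ => ‖(k : ℂ) * thetaTerm p k‖ := by
    have := summable_theta_linear hp0 hp 1 0 abs_sub_one_le_mul_sub_one
    refine this.congr fun k => ?_
    rw [thetaTerm]; push_cast; congr 1; ring
  have z0 : ∑' k, thetaTerm p k = 0 := by simpa [thetaTerm] using tsum_theta_eq_zero (p := p) 1
  have hfun : (fun x : ℤ × ℤ × ℤ => ((x.1 + x.2.1 + x.2.2 : ℤ) : ℂ) *
      (thetaTerm p x.2.1 * thetaTerm p x.2.2 * thetaTerm p x.1)) = fun x =>
      (x.1 * thetaTerm p x.1) * (thetaTerm p x.2.1 * thetaTerm p x.2.2) +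
      (thetaTerm p x.1 * ((x.2.1 * thetaTerm p x.2.1) * thetaTerm p x.2.2) +
       thetaTerm p x.1 * (thetaTerm p x.2.1 * (x.2.2 * thetaTerm p x.2.2))) := by
    ext x
    push_cast
    ring
  have t1 := summable_triple s1 s0 s0
  have t2 := summable_triple s0 s1 s0
  have t3 := summable_triple s0 s0 s1
  -- The weight k differentiates θ(z)³ at z = 1. Each resulting product still contains the factor
  -- θ(1) = 0.
  have h := tsum_thetaTerm_cube hp0 (f := fun k => (k : ℂ))
    (by rw [hfun]; exact t1.add (t2.add t3))
  rw [hfun, t1.tsum_add (t2.add t3), t2.tsum_add t3, tsum_triple s1 s0 s0, tsum_triple s0 s1 s0,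
    tsum_triple s0 s0 s1, z0] at h
  have e0 : ∑' m : ℤ, (-1) ^ m * ((3 * m : ℤ) : ℂ) * p ^ (3 * (m * (m - 1))) =
      3 * -qInf (p ^ 6) ^ 3 := by
    rw [← tsum_mul_theta hp0 hp, ← tsum_mul_left]
    exact tsum_congr fun m => by push_cast; ring
  have e1 : ∑' m : ℤ, (-1) ^ m * ((3 * m + 1 : ℤ) : ℂ) * p ^ (3 * m ^ 2 - m) =
      ∑' m : ℤ, (-1) ^ m * (-3 * m + 1 : ℂ) * p ^ (3 * m ^ 2 + m) := by
    rw [← (Equiv.neg ℤ).tsum_eq]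
    refine tsum_congr fun m => ?_
    rw [Equiv.neg_apply, neg_one_zpow_neg]
    push_cast
    congr 2 <;> ring
  have l1 := (summable_theta_linear hp0 hp (-3) 1 abs_sub_one_le_pentagonal).of_norm
  have l2 := (summable_theta_linear hp0 hp 3 2 abs_sub_one_le_pentagonal).of_norm
  push_cast at l1 l2
  have e2 : ∑' m : ℤ, (-1) ^ m * (6 * m + 1 : ℂ) * p ^ (3 * m ^ 2 + m) =
      ∑' m : ℤ, (-1) ^ m * ((3 * m + 2 : ℤ) : ℂ) * p ^ (3 * m ^ 2 + m) -
      ∑' m : ℤ, (-1) ^ m * (-3 * m + 1 : ℂ) * p ^ (3 * m ^ 2 + m) := by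
    push_cast
    rw [← l2.tsum_sub l1]
    exact tsum_congr fun m => by ring
  rw [e0, e1] at h
  rw [e2]
  linear_combination h

/-- The series of `hasSum_odd_part` as a hexagonal lattice sum. -/
lemma hasSum_odd_part_hex (hp0 : p ≠ 0) (hp : ‖p‖ < 1) :
    HasSum (fun n : ℕ => (p ^ 2) ^ (n ^ 2 + n) *
      (qPoch (p ^ 2) n ^ 2 / qPoch (p ^ 2) (2 * n + 1))) ((∑' x, p ^ hexFormShift x) / 3) := by
  have hD := qInf_ne_zero (norm_sq_lt_one hp)
  convert hasSum_odd_part hp0 hp (hasSum_odd_part_theta hp0 hp) using 1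
  field_simp
  linear_combination tsum_hexFormShift_mul hp0 hp

/-- The series of `hasSum_even_part` as a hexagonal lattice sum. -/
lemma hasSum_even_part_hex (hp0 : p ≠ 0) (hp : ‖p‖ < 1) :
    HasSum (fun n : ℕ => (p ^ 2) ^ (n ^ 2) *
      (qPoch (p ^ 2) n ^ 2 / qPoch (p ^ 2) (2 * n + 1))) ((∑' x, p ^ hexForm x + 2) / 3) := by
  have hD := qInf_ne_zero (norm_sq_lt_one hp)
  have h6 : ‖p ^ 6‖ < 1 := by
    rw [norm_pow]; exact pow_lt_one₀ (norm_nonneg p) hp (by norm_num)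
  have hJ := pow_ne_zero 3 (qInf_ne_zero h6)
  convert hasSum_even_part hp0 hp (hasSum_even_part_theta hp0 hp) using 1
  have hc := tsum_hexFormShift_mul hp0 hp
  have ha := tsum_hexForm_relation hp0 hp
  have l1 := (summable_theta_linear hp0 hp 6 1 abs_sub_one_le_pentagonal).of_norm
  have l2 := (summable_theta_one hp0 hp abs_sub_one_le_pentagonal).of_norm.mul_left 2
  push_cast at l1
  -- 3(2m + 1) = (6m + 1) + 2; the 2 multiplies the pentagonal series and becomes the 2 in (A +
  -- 2)/3.
  have e : 3 * ∑' m : ℤ, (-1) ^ m * (2 * m + 1 : ℂ) * p ^ (3 * m ^ 2 + m) =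
      ∑' m : ℤ, (-1) ^ m * (6 * m + 1 : ℂ) * p ^ (3 * m ^ 2 + m) + 2 * qInf (p ^ 2) := by
    rw [← tsum_pentagonal hp0 hp, ← tsum_mul_left, ← tsum_mul_left, ← l1.tsum_add l2]
    exact tsum_congr fun m => by ring
  have hA : (∑' x, p ^ hexForm x) * qInf (p ^ 2) =
      ∑' m : ℤ, (-1) ^ m * (6 * m + 1 : ℂ) * p ^ (3 * m ^ 2 + m) := by
    refine mul_left_cancel₀ (mul_ne_zero three_ne_zero hJ) ?_
    linear_combination qInf (p ^ 2) * ha +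
      (∑' m : ℤ, (-1) ^ m * (6 * m + 1 : ℂ) * p ^ (3 * m ^ 2 + m)) * hc
  field_simp
  linear_combination hA - e

end CubicTheta

/-! ### Quadrant sums from the symmetries of the hexagonal lattice -/

section Cones

open Filter Topology

variable {p : ℂ}

/-- Rotation by sixty degrees in the hexagonal lattice. -/
def hexRotate : ℤ × ℤ ≃ ℤ × ℤ where
  toFun x := (-x.2, x.1 + x.2)
  invFun x := (x.1 + x.2, -x.1)
  left_inv x := Prod.ext (by dsimp only; ring) (by dsimp only; ring)
  right_inv x := Prod.ext (by dsimp only; ring) (by dsimp only; ring)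

/-- Rotation by 120 degrees around the centre of a triangle of the hexagonal lattice. -/
def triangleRotate : ℤ × ℤ ≃ ℤ × ℤ where
  toFun x := (x.2, -1 - x.1 - x.2)
  invFun x := (-1 - x.1 - x.2, x.1)
  left_inv x := Prod.ext (by dsimp only; ring) (by dsimp only)
  right_inv x := Prod.ext (by dsimp only) (by dsimp only; ring)

lemma hexForm_hexRotate (x : ℤ × ℤ) : hexForm (hexRotate x) = hexForm x := by
  simp only [hexForm, hexRotate, Equiv.coe_fn_mk]; ring

lemma hexForm_swap (x : ℤ × ℤ) : hexForm x.swap = hexForm x := by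
  simp only [hexForm, Prod.fst_swap, Prod.snd_swap]; ring

lemma hexFormShift_triangleRotate (x : ℤ × ℤ) :
    hexFormShift (triangleRotate x) = hexFormShift x := by
  simp only [hexFormShift, triangleRotate, Equiv.coe_fn_mk]; ring

lemma hasSum_ite_comp {α : Type*} {f : α → ℂ} (u : α ≃ α) (hu : ∀ x, f (u x) = f x) {S : α → Prop}
    [DecidablePred S] {a : ℂ} (h : HasSum (fun x => if S x then f x else 0) a) :
    HasSum (fun x => if S (u x) then f x else 0) a := by
  have := u.hasSum_iff.2 h
  simpa only [Function.comp_def, hu] using this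

lemma hasSum_ite_tsum {α : Type*} {f : α → ℂ} (hf : Summable f) (S : α → Prop) [DecidablePred S] :
    HasSum (fun x => if S x then f x else 0) (∑' x, if S x then f x else 0) := by
  have h : Summable ({x | S x}.indicator f) := hf.indicator _
  refine Summable.hasSum ?_
  refine h.congr fun x => ?_
  by_cases hx : S x <;> simp [hx]

lemma hasSum_quadrant {f : ℤ × ℤ → ℂ} {a : ℂ} (u : ℕ × ℕ → ℤ × ℤ) (hu : Function.Injective u)
    (S : ℤ × ℤ → Prop) [DecidablePred S] (hS : ∀ x, S x ↔ x ∈ Set.range u)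
    (h : HasSum (fun x => if S x then f x else 0) a) : HasSum (fun x => f (u x)) a := by
  have := (hu.hasSum_iff (f := fun x => if S x then f x else 0) (a := a) (fun x hx => by
    rw [if_neg (by rwa [hS])])).2 h
  refine this.congr_fun fun x => ?_
  simp only [Function.comp_apply]
  rw [if_pos ((hS _).2 ⟨x, rfl⟩)]

lemma hasSum_nonneg_quadrant {f : ℤ × ℤ → ℂ} {a : ℂ}
    (h : HasSum (fun x => if 0 ≤ x.1 ∧ 0 ≤ x.2 then f x else 0) a) :
    HasSum (fun x : ℕ × ℕ => f (x.1, x.2)) a := by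
  refine hasSum_quadrant (fun x => (x.1, x.2)) ?_ (fun x => 0 ≤ x.1 ∧ 0 ≤ x.2) ?_ h
  · rintro ⟨a, b⟩ ⟨c, d⟩ h
    simpa using h
  · rintro ⟨x, y⟩
    constructor
    · rintro ⟨hx, hy⟩
      exact ⟨(x.toNat, y.toNat), Prod.ext (Int.toNat_of_nonneg hx) (Int.toNat_of_nonneg hy)⟩
    · rintro ⟨⟨a, b⟩, h⟩
      simp only [Prod.mk.injEq] at h ⊢
      lia

lemma hasSum_pos_quadrant {f : ℤ × ℤ → ℂ} {a : ℂ}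
    (h : HasSum (fun x => if 1 ≤ x.1 ∧ 1 ≤ x.2 then f x else 0) a) :
    HasSum (fun x : ℕ × ℕ => f (x.1 + 1, x.2 + 1)) a := by
  have h' := ((Equiv.addRight (1 : ℤ)).prodCongr (Equiv.addRight (1 : ℤ))).hasSum_iff.2 h
  refine hasSum_nonneg_quadrant (f := fun x => f (x.1 + 1, x.2 + 1)) (h'.congr_fun fun x => ?_)
  refine if_congr ?_ rfl rfl
  simp

lemma hasSum_neg_quadrant {f : ℤ × ℤ → ℂ} {a : ℂ}
    (h : HasSum (fun x => if x.1 ≤ -1 ∧ x.2 ≤ -1 then f x else 0) a) :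
    HasSum (fun x : ℕ × ℕ => f (-1 - x.1, -1 - x.2)) a := by
  have h' := ((Equiv.subLeft (-1 : ℤ)).prodCongr (Equiv.subLeft (-1 : ℤ))).hasSum_iff.2 h
  refine hasSum_nonneg_quadrant (f := fun x => f (-1 - x.1, -1 - x.2)) (h'.congr_fun fun x => ?_)
  refine if_congr ?_ rfl rfl
  simp

/-- The half-open sector x ≥ 1, y ≥ 0 and its five rotates tile the lattice minus the origin. The
conditions are left as iterates of `hexRotate` so that they match definitionally. -/
lemma eq_sum_hexagon_sectors (x y : ℤ) (c : ℂ) :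
    c = (if (x, y) = 0 then c else 0) + (if 1 ≤ x ∧ 0 ≤ y then c else 0) +
      (if 1 ≤ -y ∧ 0 ≤ x + y then c else 0) + (if 1 ≤ -(x + y) ∧ 0 ≤ -y + (x + y) then c else 0) +
      (if 1 ≤ -(-y + (x + y)) ∧ 0 ≤ -(x + y) + (-y + (x + y)) then c else 0) +
      (if 1 ≤ -(-(x + y) + (-y + (x + y))) ∧
        0 ≤ -(-y + (x + y)) + (-(x + y) + (-y + (x + y))) then c else 0) +
      (if 1 ≤ -(-(-y + (x + y)) + (-(x + y) + (-y + (x + y)))) ∧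
        0 ≤ -(-(x + y) + (-y + (x + y))) + (-(-y + (x + y)) + (-(x + y) + (-y + (x + y)))) then c
        else 0) := by
  simp only [Prod.mk_eq_zero]
  split_ifs <;> first | (exfalso; lia) | simp

lemma sum_quadrants_eq (x y : ℤ) (c : ℂ) :
    (if 0 ≤ x ∧ 0 ≤ y then c else 0) + (if 1 ≤ x ∧ 1 ≤ y then c else 0) =
      (if (x, y) = 0 then c else 0) + (if 1 ≤ x ∧ 0 ≤ y then c else 0) +
        (if 1 ≤ y ∧ 0 ≤ x then c else 0) := by
  simp only [Prod.mk_eq_zero]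
  split_ifs <;> first | (exfalso; lia) | simp

/-- With z = -1 - x - y, three integers of sum -1 have exactly one or exactly two nonnegative
members; the rotation permutes x, y, z cyclically. -/
lemma eq_sum_triangle_sectors (x y : ℤ) (c : ℂ) :
    c = (if 0 ≤ x ∧ 0 ≤ y then c else 0) + (if 0 ≤ y ∧ 0 ≤ -1 - x - y then c else 0) +
      (if 0 ≤ -1 - x - y ∧ 0 ≤ -1 - y - (-1 - x - y) then c else 0) +
      (if x ≤ -1 ∧ y ≤ -1 then c else 0) + (if y ≤ -1 ∧ -1 - x - y ≤ -1 then c else 0) +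
      (if -1 - x - y ≤ -1 ∧ -1 - y - (-1 - x - y) ≤ -1 then c else 0) := by
  split_ifs <;> first | (exfalso; lia) | simp

/-- If c is the sum over one half-open sector, the full sum is f(0) + 6c and the two quadrants
together give f(0) + 2c. -/
lemma hasSum_hexagon_sectors {f : ℤ × ℤ → ℂ} (hs : Summable f)
    (hR : ∀ x, f (hexRotate x) = f x) (hW : ∀ x, f (Equiv.prodComm ℤ ℤ x) = f x) :
    ∃ a b : ℂ, a + b = (∑' x, f x + 2 * f 0) / 3 ∧
      HasSum (fun x : ℕ × ℕ => f (x.1, x.2)) a ∧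
      HasSum (fun x : ℕ × ℕ => f (x.1 + 1, x.2 + 1)) b := by
  have h0 : HasSum (fun x : ℤ × ℤ => if x = 0 then f x else 0) (f 0) := by
    convert hasSum_ite_eq (0 : ℤ × ℤ) (f 0) using 2 with x
    split_ifs with h
    · rw [h]
    · rfl
  obtain ⟨c, hc⟩ : ∃ c, HasSum (fun x : ℤ × ℤ => if 1 ≤ x.1 ∧ 0 ≤ x.2 then f x else 0) c :=
    ⟨_, hasSum_ite_tsum hs _⟩
  have h1 := hasSum_ite_comp hexRotate hR hc
  have h2 := hasSum_ite_comp hexRotate hR h1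
  have h3 := hasSum_ite_comp hexRotate hR h2
  have h4 := hasSum_ite_comp hexRotate hR h3
  have h5 := hasSum_ite_comp hexRotate hR h4
  have hw := hasSum_ite_comp (Equiv.prodComm ℤ ℤ) hW hc
  obtain ⟨a, ha⟩ : ∃ a, HasSum (fun x : ℤ × ℤ => if 0 ≤ x.1 ∧ 0 ≤ x.2 then f x else 0) a :=
    ⟨_, hasSum_ite_tsum hs _⟩
  obtain ⟨b, hb⟩ : ∃ b, HasSum (fun x : ℤ × ℤ => if 1 ≤ x.1 ∧ 1 ≤ x.2 then f x else 0) b :=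
    ⟨_, hasSum_ite_tsum hs _⟩
  have hA : HasSum f (f 0 + c + c + c + c + c + c) :=
    ((((((h0.add hc).add h1).add h2).add h3).add h4).add h5).congr_fun fun x =>
      eq_sum_hexagon_sectors x.1 x.2 (f x)
  have hab : a + b = f 0 + c + c := (ha.add hb).unique (((h0.add hc).add hw).congr_fun fun x =>
    sum_quadrants_eq x.1 x.2 (f x))
  refine ⟨a, b, ?_, hasSum_nonneg_quadrant ha, hasSum_pos_quadrant hb⟩
  rw [hA.tsum_eq, hab]
  ring

lemma hasSum_triangle_sectors {f : ℤ × ℤ → ℂ} (hs : Summable f)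
    (hR : ∀ x, f (triangleRotate x) = f x) :
    ∃ a b : ℂ, a + b = (∑' x, f x) / 3 ∧
      HasSum (fun x : ℕ × ℕ => f (x.1, x.2)) a ∧
      HasSum (fun x : ℕ × ℕ => f (-1 - x.1, -1 - x.2)) b := by
  obtain ⟨a, ha⟩ : ∃ a, HasSum (fun x : ℤ × ℤ => if 0 ≤ x.1 ∧ 0 ≤ x.2 then f x else 0) a :=
    ⟨_, hasSum_ite_tsum hs _⟩
  obtain ⟨b, hb⟩ : ∃ b, HasSum (fun x : ℤ × ℤ => if x.1 ≤ -1 ∧ x.2 ≤ -1 then f x else 0) b :=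
    ⟨_, hasSum_ite_tsum hs _⟩
  have a1 := hasSum_ite_comp triangleRotate hR ha
  have a2 := hasSum_ite_comp triangleRotate hR a1
  have b1 := hasSum_ite_comp triangleRotate hR hb
  have b2 := hasSum_ite_comp triangleRotate hR b1
  have hA : HasSum f (a + a + a + b + b + b) :=
    (((((ha.add a1).add a2).add hb).add b1).add b2).congr_fun fun x =>
      eq_sum_triangle_sectors x.1 x.2 (f x)
  refine ⟨a, b, ?_, hasSum_nonneg_quadrant ha, hasSum_neg_quadrant hb⟩
  rw [hA.tsum_eq]
  ring

lemma hasSum_hexForm_cone (hp0 : p ≠ 0) (hp : ‖p‖ < 1) :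
    ∃ a b : ℂ, a + b = (∑' x, p ^ hexForm x + 2) / 3 ∧
      HasSum (fun x : ℕ × ℕ => p ^ hexForm (x.1, x.2)) a ∧
      HasSum (fun x : ℕ × ℕ => p ^ hexForm (x.1 + 1, x.2 + 1)) b := by
  have h := hasSum_hexagon_sectors (summable_hexForm hp0 hp)
    (fun x => by rw [hexForm_hexRotate])
    (fun x => by rw [Equiv.prodComm_apply, hexForm_swap])
  have h0 : p ^ hexForm 0 = 1 := by simp [hexForm]
  rwa [h0, mul_one] at h

lemma hasSum_hexFormShift_cone (hp0 : p ≠ 0) (hp : ‖p‖ < 1) :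
    ∃ a b : ℂ, a + b = (∑' x, p ^ hexFormShift x) / 3 ∧
      HasSum (fun x : ℕ × ℕ => p ^ hexFormShift (x.1, x.2)) a ∧
      HasSum (fun x : ℕ × ℕ => p ^ hexFormShift (-1 - x.1, -1 - x.2)) b :=
  hasSum_triangle_sectors (summable_hexFormShift hp0 hp)
    (fun x => by rw [hexFormShift_triangleRotate])

/-- The substitution n = x + y, j = x - y. -/
lemma sum_Icc_ite_even (n : ℕ) (g : ℤ → ℂ) :
    ∑ j ∈ Finset.Icc (-(n : ℤ)) n, (if Even ((n : ℤ) + j) then g j else 0) =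
      ∑ x ∈ Finset.HasAntidiagonal.antidiagonal n, g ((x.1 : ℤ) - x.2) := by
  rw [← Finset.sum_filter]
  refine Finset.sum_nbij' (fun j => (((n + j) / 2).toNat, ((n - j) / 2).toNat))
    (fun x => (x.1 : ℤ) - x.2) ?_ ?_ ?_ ?_ ?_
  · intro j hj
    simp only [Finset.mem_filter, Finset.mem_Icc, Int.even_iff] at hj
    simp only [Finset.HasAntidiagonal.mem_antidiagonal]; lia
  · rintro ⟨a, b⟩ hx
    simp only [Finset.HasAntidiagonal.mem_antidiagonal] at hx
    simp only [Finset.mem_filter, Finset.mem_Icc, Int.even_iff]; lia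
  · intro j hj
    simp only [Finset.mem_filter, Finset.mem_Icc, Int.even_iff] at hj
    simp only; lia
  · rintro ⟨a, b⟩ hx
    simp only [Finset.HasAntidiagonal.mem_antidiagonal] at hx
    simp only [Prod.mk.injEq]; lia
  · intro j hj
    simp only [Finset.mem_filter, Finset.mem_Icc, Int.even_iff] at hj
    congr 1
    simp only; lia

/-- The endpoints j = ±(n + 1) have the excluded parity, so this reduces to the even case for n. -/
lemma sum_Icc_ite_odd (n : ℕ) (g : ℤ → ℂ) :
    ∑ j ∈ Finset.Icc (-((n + 1 : ℕ) : ℤ)) (n + 1 : ℕ),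
      (if Even (((n + 1 : ℕ) : ℤ) + j) then 0 else g j) =
      ∑ x ∈ Finset.HasAntidiagonal.antidiagonal n, g ((x.1 : ℤ) - x.2) := by
  rw [← sum_Icc_ite_even]
  symm
  refine (Finset.sum_subset_zero_on_sdiff (Finset.Icc_subset_Icc (by lia) (by lia)) ?_ ?_)
  · intro j hj
    simp only [Finset.mem_sdiff, Finset.mem_Icc] at hj
    rw [if_pos]
    rw [Int.even_iff]; lia
  · intro j hj
    have : Even (((n + 1 : ℕ) : ℤ) + j) ↔ ¬ Even ((n : ℤ) + j) := by
      rw [Int.even_iff, Int.even_iff]; lia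
    by_cases h : Even ((n : ℤ) + j)
    · rw [if_pos h, if_neg (by tauto)]
    · rw [if_neg h, if_pos (by tauto)]

end Cones

/-! ### The partial theta double series as quadrant sums -/

section HalfSeries

open Filter Topology

variable {q r : ℂ}

lemma zpow_two_mul_eq (hr : r ^ 2 = q) (k : ℤ) : r ^ (2 * k) = q ^ k := by
  rw [zpow_mul, zpow_ofNat, hr]

lemma pow_natAbs_sq (j : ℤ) : r ^ (j.natAbs ^ 2) = r ^ (j ^ 2 : ℤ) := by
  rw [← zpow_natCast]; congr 1; simp

lemma summable_partial_theta (hr1 : ‖r‖ < 1) {u : ℕ → ℂ} {s : ℤ → ℂ} (hu : ∀ n, ‖u n‖ ≤ 4)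
    (hs : ∀ j, ‖s j‖ ≤ 1) :
    Summable fun n : ℕ => r ^ (3 * n ^ 2) * u n *
      ∑ j ∈ Finset.Icc (-(n : ℤ)) (n : ℤ), s j * r ^ (j.natAbs ^ 2) := by
  refine Summable.of_norm_bounded
    ((summable_succ_mul_geometric (norm_nonneg r) hr1).mul_left 8) fun n => ?_
  have h1 : ‖∑ j ∈ Finset.Icc (-(n : ℤ)) (n : ℤ), s j * r ^ (j.natAbs ^ 2)‖ ≤ 2 * (n + 1) := by
    refine (norm_sum_le_of_le _ (n := fun _ => (1 : ℝ)) fun j _ => ?_).trans ?_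
    · rw [norm_mul, norm_pow]
      exact mul_le_one₀ (hs j) (by positivity) (pow_le_one₀ (norm_nonneg r) hr1.le)
    · rw [Finset.sum_const, Int.card_Icc, nsmul_eq_mul, mul_one,
        show ((n : ℤ) + 1 - -n).toNat = 2 * n + 1 by lia]
      push_cast
      linarith
  have h2 : ‖r‖ ^ (3 * n ^ 2) ≤ ‖r‖ ^ n :=
    pow_le_pow_of_le_one (norm_nonneg r) hr1.le (by nlinarith [Nat.le_self_pow two_ne_zero n])
  rw [norm_mul, norm_mul, norm_pow]
  calc _ ≤ ‖r‖ ^ n * 4 * (2 * (n + 1)) := by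
        have := hu n
        gcongr
    _ = _ := by ring

lemma norm_one_add_pow_mul_le (hq1 : ‖q‖ < 1) (hr1 : ‖r‖ < 1) (a b : ℕ) {s : ℂ} (hs : ‖s‖ = 1) :
    ‖(1 + q ^ a) * (1 + s * r ^ b)‖ ≤ 4 := by
  have h1 : ‖1 + q ^ a‖ ≤ 2 := by
    refine (norm_add_le _ _).trans ?_
    rw [norm_one, norm_pow]
    linarith [pow_le_one₀ (n := a) (norm_nonneg q) hq1.le]
  have h2 : ‖1 + s * r ^ b‖ ≤ 2 := by
    refine (norm_add_le _ _).trans ?_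
    rw [norm_one, norm_mul, hs, norm_pow]
    linarith [pow_le_one₀ (n := b) (norm_nonneg r) hr1.le]
  rw [norm_mul]
  nlinarith [norm_nonneg (1 + q ^ a), norm_nonneg (1 + s * r ^ b)]

lemma summable_plus_series (hq1 : ‖q‖ < 1) (hr1 : ‖r‖ < 1) :
    Summable (fun n : ℕ => r ^ (3 * n ^ 2) * (1 + q ^ (2 * n + 1)) * (1 + r ^ (2 * n + 1)) *
      ∑ j ∈ Finset.Icc (-(n : ℤ)) (n : ℤ), r ^ (j.natAbs ^ 2)) := by
  have := summable_partial_theta hr1 (u := fun n => (1 + q ^ (2 * n + 1)) * (1 + 1 * r ^ (2 * n + 1)))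
    (s := fun _ => 1) (fun n => norm_one_add_pow_mul_le hq1 hr1 _ _ norm_one) (by simp)
  simpa only [one_mul, mul_assoc] using this

lemma summable_minus_series (hq1 : ‖q‖ < 1) (hr1 : ‖r‖ < 1) :
    Summable (fun n : ℕ => (-1 : ℂ) ^ n * r ^ (3 * n ^ 2) * (1 + q ^ (2 * n + 1)) *
      (1 - r ^ (2 * n + 1)) *
      ∑ j ∈ Finset.Icc (-(n : ℤ)) (n : ℤ), (-1 : ℂ) ^ j * r ^ (j.natAbs ^ 2)) := by
  have := summable_partial_theta hr1
    (u := fun n => (-1) ^ n * ((1 + q ^ (2 * n + 1)) * (1 + (-1) * r ^ (2 * n + 1))))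
    (s := fun j => (-1) ^ j) (fun n => ?_) (fun j => (norm_neg_one_zpow j).le)
  · refine this.congr fun n => ?_
    ring
  · rw [norm_mul, norm_pow, norm_neg, norm_one, one_pow, one_mul]
    exact norm_one_add_pow_mul_le hq1 hr1 _ _ (by simp)

/-- Each j contributes a(1 + b)/2 + (-1)^(n+j) a(1 - b)/2, which is a or ab according to the parity
of n + j. -/
lemma half_sum_series (n : ℕ) (a b : ℂ) :
    1 / 2 * (a * (1 + b) * ∑ j ∈ Finset.Icc (-(n : ℤ)) (n : ℤ), r ^ (j.natAbs ^ 2)) +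
      1 / 2 * ((-1 : ℂ) ^ n * a * (1 - b) *
        ∑ j ∈ Finset.Icc (-(n : ℤ)) (n : ℤ), (-1 : ℂ) ^ j * r ^ (j.natAbs ^ 2)) =
    ∑ j ∈ Finset.Icc (-(n : ℤ)) (n : ℤ),
        (if Even ((n : ℤ) + j) then a * r ^ (j ^ 2 : ℤ) else 0) +
      ∑ j ∈ Finset.Icc (-(n : ℤ)) (n : ℤ),
        (if Even ((n : ℤ) + j) then 0 else a * b * r ^ (j ^ 2 : ℤ)) := by
  simp only [Finset.mul_sum]
  rw [← Finset.sum_add_distrib, ← Finset.sum_add_distrib]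
  refine Finset.sum_congr rfl fun j _ => ?_
  have hs : (-1 : ℂ) ^ n * (-1) ^ j = (-1) ^ ((n : ℤ) + j) := by
    rw [zpow_add₀ (by norm_num), zpow_natCast]
  rw [pow_natAbs_sq]
  split_ifs with h
  · rw [h.neg_one_zpow] at hs
    linear_combination (1 / 2 * a * (1 - b) * r ^ (j ^ 2)) * hs
  · rw [(Int.not_even_iff_odd.1 h).neg_one_zpow] at hs
    linear_combination (1 / 2 * a * (1 - b) * r ^ (j ^ 2)) * hs

/-- 3(x + y)² + (x - y)² = 4(x² + xy + y²), and the factor 1 + q^(2n+1) splits the sum between the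
two forms. -/
lemma half_sum_even (hq0 : q ≠ 0) (hr0 : r ≠ 0) (hr : r ^ 2 = q) (n : ℕ) :
    ∑ j ∈ Finset.Icc (-(n : ℤ)) (n : ℤ),
        (if Even ((n : ℤ) + j) then r ^ (3 * n ^ 2) * (1 + q ^ (2 * n + 1)) * r ^ (j ^ 2 : ℤ)
          else 0) =
      ∑ x ∈ Finset.HasAntidiagonal.antidiagonal n,
        (q ^ hexForm (x.1, x.2) + q * q ^ hexFormShift (x.1, x.2)) := by
  rw [sum_Icc_ite_even]
  refine Finset.sum_congr rfl fun x hx => ?_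
  obtain ⟨a, b⟩ := x
  obtain rfl : a + b = n := by simpa using hx
  have e1 : r ^ (3 * (a + b) ^ 2) * r ^ (((a : ℤ) - b) ^ 2) = q ^ hexForm (a, b) := by
    rw [← zpow_two_mul_eq hr, ← zpow_natCast r, ← zpow_add₀ hr0]
    congr 1; simp only [hexForm]; push_cast; ring
  have e2 : q ^ (2 * (a + b) + 1) * q ^ hexForm (a, b) = q * q ^ hexFormShift (a, b) := by
    rw [← zpow_natCast, ← zpow_add₀ hq0, ← zpow_one_add₀ hq0]
    congr 1; simp only [hexForm, hexFormShift]; push_cast; ring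
  simp only
  linear_combination (1 + q ^ (2 * (a + b) + 1)) * e1 + e2

lemma half_sum_odd (hq0 : q ≠ 0) (hr0 : r ≠ 0) (hr : r ^ 2 = q) (n : ℕ) :
    ∑ j ∈ Finset.Icc (-((n + 1 : ℕ) : ℤ)) (n + 1 : ℕ),
        (if Even (((n + 1 : ℕ) : ℤ) + j) then 0 else
          r ^ (3 * (n + 1) ^ 2) * (1 + q ^ (2 * (n + 1) + 1)) * r ^ (2 * (n + 1) + 1) *
            r ^ (j ^ 2 : ℤ)) =
      ∑ x ∈ Finset.HasAntidiagonal.antidiagonal n,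
        (q ^ hexForm (x.1 + 1, x.2 + 1) + q * q ^ hexFormShift (-1 - x.1, -1 - x.2)) := by
  rw [sum_Icc_ite_odd]
  refine Finset.sum_congr rfl fun x hx => ?_
  obtain ⟨a, b⟩ := x
  obtain rfl : a + b = n := by simpa using hx
  have e1 : r ^ (3 * (a + b + 1) ^ 2) * r ^ (2 * (a + b + 1) + 1) * r ^ (((a : ℤ) - b) ^ 2) =
      q * q ^ hexFormShift (-1 - a, -1 - b) := by
    rw [← zpow_one_add₀ hq0, ← zpow_two_mul_eq hr, ← pow_add, ← zpow_natCast r, ← zpow_add₀ hr0]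
    congr 1; simp only [hexFormShift]; push_cast; ring
  have e2 : q ^ (2 * (a + b + 1) + 1) * (q * q ^ hexFormShift (-1 - a, -1 - b)) =
      q ^ hexForm (a + 1, b + 1) := by
    rw [← zpow_natCast, ← zpow_one_add₀ hq0, ← zpow_add₀ hq0]
    congr 1; simp only [hexForm, hexFormShift]; push_cast; ring
  simp only
  linear_combination (1 + q ^ (2 * (a + b + 1) + 1)) * e1 + e2

/-- The even part of the partial theta double series is a combination of hexagonal lattice sums. -/
lemma tsum_half_series (hq0 : q ≠ 0) (hq1 : ‖q‖ < 1) (hr : r ^ 2 = q) (hr0 : r ≠ 0)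
    (hr1 : ‖r‖ < 1) :
    1 / 2 * ∑' n : ℕ, r ^ (3 * n ^ 2) * (1 + q ^ (2 * n + 1)) * (1 + r ^ (2 * n + 1)) *
          ∑ j ∈ Finset.Icc (-(n : ℤ)) (n : ℤ), r ^ (j.natAbs ^ 2) +
        1 / 2 * ∑' n : ℕ, (-1 : ℂ) ^ n * r ^ (3 * n ^ 2) * (1 + q ^ (2 * n + 1)) *
          (1 - r ^ (2 * n + 1)) *
          ∑ j ∈ Finset.Icc (-(n : ℤ)) (n : ℤ), (-1 : ℂ) ^ j * r ^ (j.natAbs ^ 2) =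
      (∑' x, q ^ hexForm x + 2) / 3 + q * ((∑' x, q ^ hexFormShift x) / 3) := by
  obtain ⟨a, b, hab, ha, hb⟩ := hasSum_hexForm_cone hq0 hq1
  obtain ⟨c, d, hcd, hc, hd⟩ := hasSum_hexFormShift_cone hq0 hq1
  have h1 := hasSum_sum_antidiagonal (ha.add (hc.mul_left q))
  have h2 := hasSum_sum_antidiagonal (hb.add (hd.mul_left q))
  have s1 := (summable_plus_series hq1 hr1).hasSum.mul_left (1 / 2)
  have s2 := (summable_minus_series hq1 hr1).hasSum.mul_left (1 / 2)
  have h3 : HasSum (fun n : ℕ => ∑ j ∈ Finset.Icc (-(n : ℤ)) (n : ℤ),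
      (if Even ((n : ℤ) + j) then 0 else
        r ^ (3 * n ^ 2) * (1 + q ^ (2 * n + 1)) * r ^ (2 * n + 1) * r ^ (j ^ 2 : ℤ)))
      (b + q * d) := by
    -- At n = 0 only j = 0 occurs, of even parity, so the odd series may start at n = 1.
    rw [← hasSum_nat_add_iff' 1]
    have : ∑ n ∈ Finset.range 1, ∑ j ∈ Finset.Icc (-(n : ℤ)) (n : ℤ),
      (if Even ((n : ℤ) + j) then 0 else
        r ^ (3 * n ^ 2) * (1 + q ^ (2 * n + 1)) * r ^ (2 * n + 1) * r ^ (j ^ 2 : ℤ)) = 0 := by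
      simp
    rw [this, sub_zero]
    exact h2.congr_fun fun n => half_sum_odd hq0 hr0 hr n
  have h4 := h1.add h3
  have h5 := (s1.add s2).unique (h4.congr_fun fun n => by
    rw [← half_sum_even hq0 hr0 hr, ← half_sum_series n
      (r ^ (3 * n ^ 2) * (1 + q ^ (2 * n + 1))) (r ^ (2 * n + 1))]
    ring)
  rw [h5, ← hab, ← hcd]
  ring

end HalfSeries

/-! ### Encoding the pairs by multiplicities -/

section PairCodes

/-- Codes for the pairs counted by `overpartitionPairCount m`: for each even part size at most `2m`
a number of copies, in the second summand with one more copy, overlined; for each odd part size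
below `2m + 1` half the number of copies, minus one; and the number of copies of `2m + 1`. -/
abbrev PairCode (m : ℕ) := (Fin m → ℕ ⊕ ℕ) × (Fin m → ℕ) × ℕ

/-- The multiplicity of a part coded by an element of `ℕ ⊕ ℕ`. -/
def overMult : ℕ ⊕ ℕ → ℕ := Sum.elim id Nat.succ

/-- The parts of the coded overpartition. -/
def codeEvenParts {m : ℕ} (u : Fin m → ℕ ⊕ ℕ) : Multiset ℕ :=
  ∑ k, Multiset.replicate (overMult (u k)) (2 * ((k : ℕ) + 1))

/-- The overlined parts of the coded overpartition. -/
def codeOverlined {m : ℕ} (u : Fin m → ℕ ⊕ ℕ) : Finset ℕ :=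
  (Finset.univ.filter fun k => (u k).isRight).image fun k : Fin m => 2 * ((k : ℕ) + 1)

/-- The parts of the coded partition into odd parts. -/
def codeOddParts {m : ℕ} (d : Fin m → ℕ) (e : ℕ) : Multiset ℕ :=
  ∑ k, Multiset.replicate (2 * (d k + 1)) (2 * (k : ℕ) + 1) + Multiset.replicate e (2 * m + 1)

/-- The total size and the number of even parts of a coded pair. -/
def codeStat {m : ℕ} (c : PairCode m) : ℕ × ℕ :=
  ((codeEvenParts c.1).sum + (codeOddParts c.2.1 c.2.2).sum, (codeEvenParts c.1).card)

lemma count_sum_replicate {ι : Type*} [Fintype ι] [DecidableEq ι] {g : ι → ℕ}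
    (hg : Function.Injective g) (f : ι → ℕ) (k : ι) :
    (∑ i, Multiset.replicate (f i) (g i)).count (g k) = f k := by
  simp only [Multiset.count_sum', Multiset.count_replicate, hg.eq_iff]
  simp

lemma sum_replicate_count {ι : Type*} [Fintype ι] [DecidableEq ι] {g : ι → ℕ}
    (hg : Function.Injective g) (M : Multiset ℕ) (h : ∀ i ∈ M, ∃ k, g k = i) :
    ∑ i, Multiset.replicate (M.count (g i)) (g i) = M := by
  ext a
  by_cases ha : ∃ k, g k = a
  · obtain ⟨k, rfl⟩ := ha
    exact count_sum_replicate hg _ k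
  · rw [Multiset.count_eq_zero.2 fun h' => ha (h a h'), Multiset.count_eq_zero]
    intro h'
    rw [Multiset.mem_sum] at h'
    obtain ⟨i, -, hi⟩ := h'
    exact ha ⟨i, (Multiset.eq_of_mem_replicate hi).symm⟩

lemma even_part_injective (m : ℕ) :
    Function.Injective fun k : Fin m => 2 * ((k : ℕ) + 1) := by
  intro a b h
  ext
  simpa using h

lemma odd_part_injective (m : ℕ) :
    Function.Injective fun k : Fin m => 2 * (k : ℕ) + 1 := by
  intro a b h
  ext
  simpa using h

variable {m : ℕ}

lemma count_codeEvenParts (u : Fin m → ℕ ⊕ ℕ) (k : Fin m) :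
    (codeEvenParts u).count (2 * ((k : ℕ) + 1)) = overMult (u k) :=
  count_sum_replicate (even_part_injective m) (fun k => overMult (u k)) k

lemma mem_codeEvenParts {u : Fin m → ℕ ⊕ ℕ} {i : ℕ} (h : i ∈ codeEvenParts u) :
    ∃ k : Fin m, i = 2 * ((k : ℕ) + 1) := by
  rw [codeEvenParts, Multiset.mem_sum] at h
  obtain ⟨k, -, hk⟩ := h
  exact ⟨k, Multiset.eq_of_mem_replicate hk⟩

lemma mem_codeOverlined {u : Fin m → ℕ ⊕ ℕ} (k : Fin m) :
    2 * ((k : ℕ) + 1) ∈ codeOverlined u ↔ (u k).isRight := by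
  simp only [codeOverlined, Finset.mem_image, Finset.mem_filter, Finset.mem_univ, true_and]
  constructor
  · rintro ⟨k', h, hk⟩
    rwa [← even_part_injective m hk]
  · exact fun h => ⟨k, h, rfl⟩

/-- Treats 2m + 1 as the last of m + 1 distinct odd sizes, so that the general counting lemmas
apply. -/
lemma codeOddParts_eq (d : Fin m → ℕ) (e : ℕ) : codeOddParts d e =
    ∑ k : Fin (m + 1), Multiset.replicate
      (Fin.snoc (α := fun _ => ℕ) (fun k => 2 * (d k + 1)) e k) (2 * (k : ℕ) + 1) := by
  rw [Fin.sum_univ_castSucc]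
  simp [codeOddParts]

lemma count_codeOddParts (d : Fin m → ℕ) (e : ℕ) (k : Fin m) :
    (codeOddParts d e).count (2 * (k : ℕ) + 1) = 2 * (d k + 1) := by
  rw [codeOddParts_eq]
  have := count_sum_replicate (odd_part_injective (m + 1))
    (Fin.snoc (α := fun _ => ℕ) (fun k => 2 * (d k + 1)) e) k.castSucc
  simpa using this

lemma count_codeOddParts_last (d : Fin m → ℕ) (e : ℕ) :
    (codeOddParts d e).count (2 * m + 1) = e := by
  rw [codeOddParts_eq]
  have := count_sum_replicate (odd_part_injective (m + 1))
    (Fin.snoc (α := fun _ => ℕ) (fun k => 2 * (d k + 1)) e) (Fin.last m)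
  simpa using this

lemma mem_codeOddParts {d : Fin m → ℕ} {e i : ℕ} (h : i ∈ codeOddParts d e) :
    ∃ k ≤ m, i = 2 * k + 1 := by
  rw [codeOddParts_eq, Multiset.mem_sum] at h
  obtain ⟨k, -, hk⟩ := h
  exact ⟨k, Nat.lt_succ_iff.1 k.2, Multiset.eq_of_mem_replicate hk⟩

/-- The pairs counted by `overpartitionPairCount m j n`. -/
abbrev OverpartitionPair (m j n : ℕ) :=
  {x : Σ p : Finset.HasAntidiagonal.antidiagonal n, Overpartition p.1.1 × Nat.Partition p.1.2 //
    x.2.1.IsEvenBounded m j ∧ IsOddEvenlyRepeated m x.2.2}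

/-- The two sizes are the sums of the parts, so the dependent indices carry no extra data. -/
lemma overpartitionPair_ext {j n : ℕ} {x y : OverpartitionPair m j n}
    (h1 : x.1.2.1.toPartition.parts = y.1.2.1.toPartition.parts)
    (h2 : x.1.2.1.overlined = y.1.2.1.overlined) (h3 : x.1.2.2.parts = y.1.2.2.parts) : x = y := by
  obtain ⟨⟨⟨⟨a, b⟩, hab⟩, ⟨⟨⟨M, hM, hMs⟩, S, hS⟩, ⟨L, hL, hLs⟩⟩⟩, hx⟩ := x
  obtain ⟨⟨⟨⟨a', b'⟩, hab'⟩, ⟨⟨⟨M', hM', hMs'⟩, S', hS'⟩, ⟨L', hL', hLs'⟩⟩⟩, hx'⟩ := y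
  change M = M' at h1
  change S = S' at h2
  change L = L' at h3
  subst h1 h2 h3
  obtain rfl : a = a' := hMs.symm.trans hMs'
  obtain rfl : b = b' := hLs.symm.trans hLs'
  rfl

/-- The pair of partitions with a given code. -/
def pairOfCode {j n : ℕ} (c : {c : PairCode m // codeStat c = (n, j)}) :
    OverpartitionPair m j n :=
  ⟨⟨⟨((codeEvenParts c.1.1).sum, (codeOddParts c.1.2.1 c.1.2.2).sum),
      Finset.HasAntidiagonal.mem_antidiagonal.2 (congrArg Prod.fst c.2)⟩,
    ⟨⟨codeEvenParts c.1.1, fun h => by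
          obtain ⟨k, hk⟩ := mem_codeEvenParts h; lia, rfl⟩,
        codeOverlined c.1.1, fun i hi => by
          simp only [codeOverlined, Finset.mem_image, Finset.mem_filter, Finset.mem_univ,
            true_and] at hi
          obtain ⟨k, hk, rfl⟩ := hi
          rw [Multiset.mem_toFinset, ← Multiset.count_pos, count_codeEvenParts]
          obtain ⟨x, hx⟩ := Sum.isRight_iff.1 hk
          simp [hx, overMult]⟩,
      ⟨codeOddParts c.1.2.1 c.1.2.2, fun h => by
          obtain ⟨k, -, hk⟩ := mem_codeOddParts h; lia, rfl⟩⟩,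
    ⟨⟨fun i hi => by
        obtain ⟨k, rfl⟩ := mem_codeEvenParts hi
        exact ⟨even_two_mul _, by have := k.2; lia⟩, congrArg Prod.snd c.2⟩,
      fun i hi => by
        obtain ⟨k, hk, rfl⟩ := mem_codeOddParts hi
        exact ⟨⟨k, rfl⟩, by lia⟩,
      fun i hi hi' => by
        obtain ⟨k, rfl⟩ := hi
        have := count_codeOddParts c.1.2.1 c.1.2.2 ⟨k, by lia⟩
        simp only at this
        refine ⟨?_, ?_⟩
        · rw [← Multiset.count_pos, this]; positivity
        · rw [this]; exact even_two_mul _⟩⟩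

lemma pairOfCode_injective {j n : ℕ} : Function.Injective (pairOfCode (m := m) (j := j) (n := n)) := by
  rintro ⟨⟨u, d, e⟩, hc⟩ ⟨⟨u', d', e'⟩, hc'⟩ h
  have h1 : codeEvenParts u = codeEvenParts u' :=
    congrArg (fun x : OverpartitionPair m j n => x.1.2.1.toPartition.parts) h
  have h2 : codeOverlined u = codeOverlined u' :=
    congrArg (fun x : OverpartitionPair m j n => x.1.2.1.overlined) h
  have h3 : codeOddParts d e = codeOddParts d' e' :=
    congrArg (fun x : OverpartitionPair m j n => x.1.2.2.parts) h
  have hu : u = u' := by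
    ext1 k
    have a1 := count_codeEvenParts u k
    rw [h1, count_codeEvenParts] at a1
    have a2 := mem_codeOverlined (u := u) k
    rw [h2, mem_codeOverlined] at a2
    rcases hk : u k with x | x <;> rcases hk' : u' k with y | y <;>
      simp_all [overMult]
  have hd : d = d' := by
    ext1 k
    have a1 := count_codeOddParts d e k
    rw [h3, count_codeOddParts] at a1
    lia
  have he : e = e' := by
    rw [← count_codeOddParts_last d e, h3, count_codeOddParts_last]
  subst hu hd he
  rfl

lemma pairOfCode_surjective {j n : ℕ} :
    Function.Surjective (pairOfCode (m := m) (j := j) (n := n)) := by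
  rintro ⟨⟨⟨⟨a, b⟩, hab⟩, ⟨⟨⟨M, hM, hMs⟩, S, hS⟩, ⟨L, hL, hLs⟩⟩⟩, ⟨hE1, hE2⟩, hO1, hO2⟩
  simp only at hE1 hE2 hO1 hO2 hS
  -- An overlined size occurs at least once and an odd size below 2m + 1 at least twice, so neither
  -- truncated subtraction by 1 loses information.
  set u : Fin m → ℕ ⊕ ℕ := fun k => if 2 * ((k : ℕ) + 1) ∈ S then
    Sum.inr (M.count (2 * ((k : ℕ) + 1)) - 1) else Sum.inl (M.count (2 * ((k : ℕ) + 1))) with hu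
  set d : Fin m → ℕ := fun k => L.count (2 * (k : ℕ) + 1) / 2 - 1 with hd
  set e : ℕ := L.count (2 * m + 1) with he
  have hMk (i : ℕ) (hi : i ∈ M) : ∃ k : Fin m, 2 * ((k : ℕ) + 1) = i := by
    obtain ⟨⟨x, hx⟩, hi2⟩ := hE1 i hi
    have := hM hi
    exact ⟨⟨x - 1, by lia⟩, by simp only; lia⟩
  have e1 : codeEvenParts u = M := by
    rw [codeEvenParts]
    convert sum_replicate_count (even_part_injective m) M hMk using 3 with k
    simp only [hu]
    split_ifs with h
    · have := Multiset.count_pos.2 (Multiset.mem_toFinset.1 (hS h))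
      simp only [overMult, Sum.elim_inr]
      lia
    · simp [overMult]
  have e2 : codeOverlined u = S := by
    ext i
    constructor
    · intro h
      simp only [codeOverlined, Finset.mem_image, Finset.mem_filter, Finset.mem_univ,
        true_and] at h
      obtain ⟨k, hk, rfl⟩ := h
      by_contra hns
      simp [hu, hns] at hk
    · intro h
      obtain ⟨k, rfl⟩ := hMk i (Multiset.mem_toFinset.1 (hS h))
      rw [mem_codeOverlined]
      simp [hu, h]
  have e3 : codeOddParts d e = L := by
    rw [codeOddParts_eq]
    have hLk (i : ℕ) (hi : i ∈ L) : ∃ k : Fin (m + 1), 2 * (k : ℕ) + 1 = i := by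
      obtain ⟨⟨x, hx⟩, hi2⟩ := hO1 i hi
      exact ⟨⟨x, by lia⟩, by simp only; lia⟩
    convert sum_replicate_count (odd_part_injective (m + 1)) L hLk using 3 with k
    refine Fin.lastCases ?_ (fun k => ?_) k
    · simp [he]
    · simp only [Fin.snoc_castSucc, Fin.val_castSucc, hd]
      obtain ⟨h1, ⟨y, hy⟩⟩ := hO2 (2 * (k : ℕ) + 1) ⟨k, rfl⟩ (by have := k.2; lia)
      have := Multiset.count_pos.2 h1
      lia
  refine ⟨⟨(u, d, e), ?_⟩, ?_⟩
  · rw [codeStat]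
    simp only [e1, e3, hE2, hMs, hLs]
    rw [Finset.HasAntidiagonal.mem_antidiagonal.1 hab]
  · exact overpartitionPair_ext e1 e2 e3

lemma card_code_fiber (j n : ℕ) :
    Nat.card {c : PairCode m // codeStat c = (n, j)} = overpartitionPairCount m j n :=
  Nat.card_congr (Equiv.ofBijective _ ⟨pairOfCode_injective, pairOfCode_surjective⟩)

instance finite_code_fiber (j n : ℕ) : Finite {c : PairCode m // codeStat c = (n, j)} :=
  Finite.of_injective _ pairOfCode_injective

end PairCodes

/-! ### Generating functions and absolute convergence -/

section GeneratingFunction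

open Filter Topology

lemma hasSum_mul_of_summable_norm {ι κ : Type*} {f : ι → ℂ} {g : κ → ℂ} {a b : ℂ}
    (hf : HasSum f a) (hg : HasSum g b) (hf' : Summable fun i => ‖f i‖)
    (hg' : Summable fun k => ‖g k‖) : HasSum (fun x : ι × κ => f x.1 * g x.2) (a * b) :=
  hf.mul hg (summable_mul_of_summable_norm hf' hg')

lemma hasSum_pi_prod {α : Type*} (m : ℕ) (f : Fin m → α → ℂ) (a : Fin m → ℂ)
    (hs : ∀ k, Summable fun x => ‖f k x‖) (ha : ∀ k, HasSum (f k) (a k)) :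
    (Summable fun c : Fin m → α => ‖∏ k, f k (c k)‖) ∧
      HasSum (fun c : Fin m → α => ∏ k, f k (c k)) (∏ k, a k) := by
  induction m with
  | zero =>
    refine ⟨Summable.of_finite, ?_⟩
    simp only [Finset.univ_eq_empty, Finset.prod_empty]
    exact hasSum_unique (fun _ : Fin 0 → α => (1 : ℂ))
  | succ m ih =>
    obtain ⟨h1, h2⟩ := ih (fun k => f k.succ) (fun k => a k.succ) (fun k => hs k.succ)
      fun k => ha k.succ
    obtain ⟨E, hE⟩ : ∃ E : α × (Fin m → α) ≃ (Fin (m + 1) → α),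
        ∀ x, ∏ k, f k (E x k) = f 0 x.1 * ∏ k : Fin m, f k.succ (x.2 k) :=
      ⟨Fin.consEquiv fun _ => α, fun x => by simp [Fin.consEquiv, Fin.prod_univ_succ]⟩
    have h3 := (hs 0).mul_norm h1
    have h4 := hasSum_mul_of_summable_norm (ha 0) h2 (hs 0) h1
    simp only [← hE] at h3 h4
    rw [← Fin.prod_univ_succ] at h4
    exact ⟨E.summable_iff.1 h3, E.hasSum_iff.1 h4⟩

/-- Plain copies contribute 1/(1 - x), and copies with the first overlined contribute x/(1 - x). -/
lemma hasSum_pow_overMult {x : ℂ} (hx : ‖x‖ < 1) :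
    (Summable fun u : ℕ ⊕ ℕ => ‖x ^ overMult u‖) ∧
      HasSum (fun u : ℕ ⊕ ℕ => x ^ overMult u) ((1 + x) / (1 - x)) := by
  have hx1 : 1 - x ≠ 0 := by simpa using one_sub_pow_ne_zero hx one_ne_zero
  have hg := hasSum_geometric_of_norm_lt_one hx
  have hn := summable_geometric_of_lt_one (norm_nonneg x) hx
  constructor
  · refine Summable.sum _ ?_ ?_
    · simpa [Function.comp_def, overMult] using hn
    · simpa [Function.comp_def, overMult] using (summable_nat_add_iff 1).2 hn
  · rw [show (1 + x) / (1 - x) = (1 - x)⁻¹ + x * (1 - x)⁻¹ by field_simp]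
    refine HasSum.sum ?_ ?_
    · simpa [Function.comp_def, overMult] using hg
    · simpa [Function.comp_def, overMult, pow_succ'] using hg.mul_left x

lemma hasSum_pow_succ {x : ℂ} (hx : ‖x‖ < 1) :
    (Summable fun n : ℕ => ‖x ^ (n + 1)‖) ∧ HasSum (fun n : ℕ => x ^ (n + 1)) (x / (1 - x)) := by
  constructor
  · simpa using (summable_nat_add_iff 1).2 (summable_geometric_of_lt_one (norm_nonneg x) hx)
  · simpa [pow_succ', div_eq_mul_inv] using (hasSum_geometric_of_norm_lt_one hx).mul_left x

/-- The generating function of the pairs counted by `overpartitionPairCount m`, with `s` marking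
the even parts. -/
noncomputable def pairGenFun (m : ℕ) (s q : ℂ) : ℂ :=
  (∏ k : Fin m, (1 + s * q ^ (2 * ((k : ℕ) + 1))) / (1 - s * q ^ (2 * ((k : ℕ) + 1)))) *
    ((∏ k : Fin m, q ^ (2 * (2 * (k : ℕ) + 1)) / (1 - q ^ (2 * (2 * (k : ℕ) + 1)))) *
      (1 - q ^ (2 * m + 1))⁻¹)

lemma weight_codeStat {m : ℕ} (s q : ℂ) (c : PairCode m) :
    s ^ (codeStat c).2 * q ^ (codeStat c).1 =
      (∏ k : Fin m, (s * q ^ (2 * ((k : ℕ) + 1))) ^ overMult (c.1 k)) *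
        ((∏ k : Fin m, (q ^ (2 * (2 * (k : ℕ) + 1))) ^ (c.2.1 k + 1)) *
          (q ^ (2 * m + 1)) ^ c.2.2) := by
  obtain ⟨u, d, e⟩ := c
  have h1 : (codeEvenParts u).card = ∑ k, overMult (u k) := by
    simp [codeEvenParts, Multiset.card_sum]
  have h2 : (codeEvenParts u).sum = ∑ k, overMult (u k) * (2 * ((k : ℕ) + 1)) := by
    simp [codeEvenParts, Multiset.sum_sum]
  have h3 : (codeOddParts d e).sum =
      ∑ k, 2 * (d k + 1) * (2 * (k : ℕ) + 1) + e * (2 * m + 1) := by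
    simp [codeOddParts, Multiset.sum_sum]
  simp only [codeStat, h1, h2, h3]
  rw [pow_add, pow_add, ← Finset.prod_pow_eq_pow_sum, ← Finset.prod_pow_eq_pow_sum,
    ← Finset.prod_pow_eq_pow_sum, ← mul_assoc, ← Finset.prod_mul_distrib]
  congr 1
  · refine Finset.prod_congr rfl fun k _ => ?_
    rw [mul_pow, ← pow_mul, mul_comm (overMult _)]
  · congr 1
    · refine Finset.prod_congr rfl fun k _ => ?_
      rw [← pow_mul]
      congr 1
      ring
    · rw [← pow_mul, mul_comm]

lemma hasSum_weight_codeStat {m : ℕ} {s q : ℂ} (hs : ‖s‖ = 1) (hq : ‖q‖ < 1) :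
    HasSum (fun c : PairCode m => s ^ (codeStat c).2 * q ^ (codeStat c).1) (pairGenFun m s q) := by
  simp only [weight_codeStat]
  have hpow (k : ℕ) (hk : k ≠ 0) : ‖q ^ k‖ < 1 := by
    rw [norm_pow]; exact pow_lt_one₀ (norm_nonneg q) hq hk
  have hx (k : Fin m) : ‖s * q ^ (2 * ((k : ℕ) + 1))‖ < 1 := by
    rw [norm_mul, hs, one_mul]; exact hpow _ (by lia)
  have hy (k : Fin m) : ‖q ^ (2 * (2 * (k : ℕ) + 1))‖ < 1 := hpow _ (by lia)
  have hz := hpow (2 * m + 1) (by lia)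
  obtain ⟨a1, a2⟩ := hasSum_pi_prod m
    (fun k u => (s * q ^ (2 * ((k : ℕ) + 1))) ^ overMult u) _
    (fun k => (hasSum_pow_overMult (hx k)).1) fun k => (hasSum_pow_overMult (hx k)).2
  obtain ⟨b1, b2⟩ := hasSum_pi_prod m (fun k d => (q ^ (2 * (2 * (k : ℕ) + 1))) ^ (d + 1)) _
    (fun k => (hasSum_pow_succ (hy k)).1) fun k => (hasSum_pow_succ (hy k)).2
  have c1 : Summable fun e : ℕ => ‖(q ^ (2 * m + 1)) ^ e‖ := by
    simpa only [norm_pow] using summable_geometric_of_lt_one (norm_nonneg _) hz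
  have c2 := hasSum_geometric_of_norm_lt_one hz
  have d1 := b1.mul_norm c1
  have d2 := hasSum_mul_of_summable_norm b2 c2 b1 c1
  have := hasSum_mul_of_summable_norm a2 d2 a1 d1
  exact this

lemma hasSum_overpartitionPairCount {m : ℕ} {s q : ℂ} (hs : ‖s‖ = 1) (hq : ‖q‖ < 1) :
    HasSum (fun t : ℕ × ℕ => s ^ t.2 * (overpartitionPairCount m t.2 t.1 : ℂ) * q ^ t.1)
      (pairGenFun m s q) := by
  have h := (Equiv.sigmaFiberEquiv (codeStat (m := m))).hasSum_iff.2
    (hasSum_weight_codeStat (m := m) hs hq)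
  refine h.sigma fun t => ?_
  obtain ⟨n, j⟩ := t
  have : Fintype {c : PairCode m // codeStat c = (n, j)} := Fintype.ofFinite _
  have hc : ∀ c : {c : PairCode m // codeStat c = (n, j)},
      ((fun c : PairCode m => s ^ (codeStat c).2 * q ^ (codeStat c).1) ∘
        Equiv.sigmaFiberEquiv codeStat) ⟨(n, j), c⟩ = s ^ j * q ^ n := by
    intro c
    simp [Equiv.sigmaFiberEquiv, c.2]
  simp only [hc]
  convert hasSum_fintype (fun _ : {c : PairCode m // codeStat c = (n, j)} => s ^ j * q ^ n) using 1
  rw [Finset.sum_const, Finset.card_univ, ← Nat.card_eq_fintype_card, card_code_fiber, nsmul_eq_mul]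
  ring

/-- Each odd size below 2m + 1 occurs at least twice, giving size at least 2(1 + 3 + ... + (2m - 1))
= 2m². This Gaussian decay beats the exponential bound on the remaining 2m + 1 factors. -/
lemma norm_pairGenFun_le {m : ℕ} {s q : ℂ} (hs : ‖s‖ = 1) (hq : ‖q‖ < 1) :
    ‖pairGenFun m s q‖ ≤ (2 / (1 - ‖q‖)) ^ (2 * m + 1) * ‖q‖ ^ (2 * m ^ 2) := by
  have h1q : 0 < 1 - ‖q‖ := by linarith
  have hden (x : ℂ) (hx : ‖x‖ ≤ ‖q‖) : ‖(1 - x)⁻¹‖ ≤ (1 - ‖q‖)⁻¹ := by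
    rw [norm_inv]
    refine inv_anti₀ h1q ?_
    have := norm_sub_norm_le (1 : ℂ) x
    rw [norm_one] at this
    linarith
  have hpow (k : ℕ) (hk : k ≠ 0) : ‖q ^ k‖ ≤ ‖q‖ := by
    rw [norm_pow]; exact pow_le_of_le_one (norm_nonneg q) hq.le hk
  have hK : (1 - ‖q‖)⁻¹ ≤ 2 / (1 - ‖q‖) := by
    rw [inv_eq_one_div]; gcongr; norm_num
  have hconst : (2 / (1 - ‖q‖)) ^ m = ∏ _k : Fin m, 2 / (1 - ‖q‖) := by
    rw [Finset.prod_const, Finset.card_univ, Fintype.card_fin]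
  have e1 : ‖∏ k : Fin m, (1 + s * q ^ (2 * ((k : ℕ) + 1))) / (1 - s * q ^ (2 * ((k : ℕ) + 1)))‖ ≤
      (2 / (1 - ‖q‖)) ^ m := by
    rw [norm_prod, hconst]
    refine Finset.prod_le_prod (fun _ _ => norm_nonneg _) fun k _ => ?_
    have hx : ‖s * q ^ (2 * ((k : ℕ) + 1))‖ ≤ ‖q‖ := by
      rw [norm_mul, hs, one_mul]; exact hpow _ (by lia)
    rw [div_eq_mul_inv, norm_mul, div_eq_mul_inv]
    refine mul_le_mul ?_ (hden _ hx) (norm_nonneg _) zero_le_two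
    refine (norm_add_le _ _).trans ?_
    rw [norm_one]; linarith
  have e2 : ‖∏ k : Fin m, q ^ (2 * (2 * (k : ℕ) + 1)) / (1 - q ^ (2 * (2 * (k : ℕ) + 1)))‖ ≤
      (2 / (1 - ‖q‖)) ^ m * ‖q‖ ^ (2 * m ^ 2) := by
    have hprod : ∀ n : ℕ, ∏ k : Fin n, ‖q‖ ^ (2 * (2 * (k : ℕ) + 1)) = ‖q‖ ^ (2 * n ^ 2) := by
      intro n
      induction n with
      | zero => simp
      | succ n ih =>
        rw [Fin.prod_univ_castSucc]
        simp only [Fin.val_castSucc, Fin.val_last]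
        rw [ih, ← pow_add]
        congr 1; ring
    rw [norm_prod, ← hprod, hconst, ← Finset.prod_mul_distrib]
    refine Finset.prod_le_prod (fun _ _ => norm_nonneg _) fun k _ => ?_
    rw [div_eq_mul_inv, norm_mul, norm_pow, mul_comm]
    gcongr
    exact (hden _ (hpow _ (by lia))).trans hK
  have e3 : ‖(1 - q ^ (2 * m + 1))⁻¹‖ ≤ 2 / (1 - ‖q‖) := (hden _ (hpow _ (by lia))).trans hK
  rw [pairGenFun, norm_mul, norm_mul]
  calc _ ≤ (2 / (1 - ‖q‖)) ^ m * (((2 / (1 - ‖q‖)) ^ m * ‖q‖ ^ (2 * m ^ 2)) * (2 / (1 - ‖q‖))) := by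
        gcongr
    _ = _ := by ring

lemma summable_pow_mul_pow_sq {K ρ : ℝ} (hK : 0 < K) (h0 : 0 < ρ) (h1 : ρ < 1) :
    Summable fun m : ℕ => K ^ (2 * m + 1) * ρ ^ (2 * m ^ 2) := by
  refine summable_of_ratio_test_tendsto_lt_one (l := 0) one_pos
    (Eventually.of_forall fun m => by positivity) ?_
  have hlim : Tendsto (fun m : ℕ => K ^ 2 * ρ ^ 2 * (ρ ^ 4) ^ m) atTop (𝓝 0) := by
    simpa using (tendsto_pow_atTop_nhds_zero_of_lt_one (by positivity)
      (pow_lt_one₀ h0.le h1 (by norm_num : 4 ≠ 0))).const_mul (K ^ 2 * ρ ^ 2)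
  refine hlim.congr fun m => ?_
  rw [Real.norm_of_nonneg (by positivity), Real.norm_of_nonneg (by positivity),
    eq_div_iff (by positivity)]
  ring

/-- With Q = q², ∏ (1 - Q^k)/(1 + Q^k) = (Q;Q)_m² / ∏ (1 - Q^(2k)), and the odd parts supply the
remaining factors of (Q;Q)_(2m). The part 2m + 1 contributes 1/(1 - q^(2m+1)) = (1 + q^(2m+1))/(1 -
Q^(2m+1)), which splits the result in two. -/
lemma pairGenFun_neg_one (m : ℕ) {q : ℂ} (hq : ‖q‖ < 1) :
    pairGenFun m (-1) q = (q ^ 2) ^ (m ^ 2) *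
        (qPoch (q ^ 2) m ^ 2 / qPoch (q ^ 2) (2 * m + 1)) +
      q * ((q ^ 2) ^ (m ^ 2 + m) * (qPoch (q ^ 2) m ^ 2 / qPoch (q ^ 2) (2 * m + 1))) := by
  have hQ := norm_sq_lt_one hq
  have key : ∀ n : ℕ,
      (∏ k : Fin n, (1 + (-1) * q ^ (2 * ((k : ℕ) + 1))) / (1 - (-1) * q ^ (2 * ((k : ℕ) + 1)))) *
      (∏ k : Fin n, q ^ (2 * (2 * (k : ℕ) + 1)) / (1 - q ^ (2 * (2 * (k : ℕ) + 1)))) =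
      (q ^ 2) ^ (n ^ 2) * (qPoch (q ^ 2) n ^ 2 / qPoch (q ^ 2) (2 * n)) := by
    intro n
    induction n with
    | zero => simp
    | succ n ih =>
      rw [Fin.prod_univ_castSucc, Fin.prod_univ_castSucc]
      simp only [Fin.val_castSucc, Fin.val_last]
      rw [mul_mul_mul_comm, ih, show 2 * (n + 1) = 2 * n + 1 + 1 by ring, qPoch_succ, qPoch_succ,
        qPoch_succ]
      have h1 := qPoch_ne_zero hQ (2 * n)
      have h2 := one_sub_pow_ne_zero hQ (Nat.succ_ne_zero (2 * n))
      have h3 := one_sub_pow_ne_zero hQ (Nat.succ_ne_zero n)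
      have h4 := one_add_pow_ne_zero hQ (Nat.succ_ne_zero n)
      rw [Nat.succ_eq_add_one] at h2 h3 h4
      have e1 : 1 - (q ^ 2) ^ (2 * n + 1 + 1) = (1 - (q ^ 2) ^ (n + 1)) * (1 + (q ^ 2) ^ (n + 1)) := by
        ring
      have e2 : q ^ (2 * n + 1 + 1) = (q ^ 2) ^ (n + 1) := by ring
      have e3 : q ^ (2 * (2 * n + 1)) = (q ^ 2) ^ (2 * n + 1) := by ring
      have e4 : (q ^ 2) ^ ((n + 1) ^ 2) = (q ^ 2) ^ (n ^ 2) * (q ^ 2) ^ (2 * n + 1) := by ring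
      rw [e1, e2, e3, e4, neg_one_mul, ← sub_eq_add_neg, sub_neg_eq_add]
      generalize (q ^ 2) ^ (n + 1) = x at *
      generalize (q ^ 2) ^ (2 * n + 1) = y at *
      field_simp
  have h1 := qPoch_ne_zero hQ (2 * m)
  have h2 := one_sub_pow_ne_zero hQ (Nat.succ_ne_zero (2 * m))
  have h3 := one_sub_pow_ne_zero hq (Nat.succ_ne_zero (2 * m))
  rw [Nat.succ_eq_add_one] at h2 h3
  have e1 : 1 - (q ^ 2) ^ (2 * m + 1) = (1 - q ^ (2 * m + 1)) * (1 + q ^ (2 * m + 1)) := by ring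
  have e2 : q * (q ^ 2) ^ (m ^ 2 + m) = q ^ (2 * m + 1) * (q ^ 2) ^ (m ^ 2) := by ring
  rw [e1] at h2
  have h5 := right_ne_zero_of_mul h2
  rw [pairGenFun, ← mul_assoc, key, qPoch_succ, e1, ← mul_assoc q, e2]
  generalize q ^ (2 * m + 1) = x at *
  field_simp

/-- The norms of the terms form the unsigned generating function at ‖q‖, whose sum over m converges
by the Gaussian bound. Absolute convergence then permits summing over each m first. -/
lemma hasSum_signed_pairs {q : ℂ} (hq0 : q ≠ 0) (hq : ‖q‖ < 1) {a : ℂ}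
    (ha : HasSum (fun m => pairGenFun m (-1) q) a) :
    HasSum (fun t : ℕ × ℕ × ℕ =>
      (-1 : ℂ) ^ t.2.2 * (overpartitionPairCount t.1 t.2.2 t.2.1 : ℂ) * q ^ t.2.1) a := by
  have hρ0 : 0 < ‖q‖ := norm_pos_iff.2 hq0
  have hn : ‖(‖q‖ : ℂ)‖ = ‖q‖ := by simp
  have hnorm (t : ℕ × ℕ × ℕ) :
      (‖(-1 : ℂ) ^ t.2.2 * (overpartitionPairCount t.1 t.2.2 t.2.1 : ℂ) * q ^ t.2.1‖ : ℂ) =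
      1 ^ t.2.2 * (overpartitionPairCount t.1 t.2.2 t.2.1 : ℂ) * (‖q‖ : ℂ) ^ t.2.1 := by
    rw [norm_mul, norm_mul, norm_pow, norm_neg, norm_one, norm_pow, Complex.norm_natCast]
    push_cast
    ring
  have hpos (m : ℕ) := hasSum_overpartitionPairCount (m := m) (s := 1) (q := (‖q‖ : ℂ)) norm_one
    (by rw [hn]; exact hq)
  have hsum : Summable fun t : ℕ × ℕ × ℕ =>
      ‖(-1 : ℂ) ^ t.2.2 * (overpartitionPairCount t.1 t.2.2 t.2.1 : ℂ) * q ^ t.2.1‖ := by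
    rw [summable_prod_of_nonneg fun _ => norm_nonneg _]
    have hm (m : ℕ) : HasSum (fun t : ℕ × ℕ =>
        (‖(-1 : ℂ) ^ t.2 * (overpartitionPairCount m t.2 t.1 : ℂ) * q ^ t.1‖ : ℂ))
        (pairGenFun m 1 ‖q‖) :=
      (hpos m).congr_fun fun t => hnorm (m, t)
    refine ⟨fun m => Complex.summable_ofReal.1 (hm m).summable, ?_⟩
    have hK : 0 < 2 / (1 - ‖q‖) := div_pos two_pos (by linarith)
    refine Summable.of_nonneg_of_le (fun m => tsum_nonneg fun _ => norm_nonneg _) (fun m => ?_)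
      (summable_pow_mul_pow_sq hK hρ0 hq)
    have h1 := (hm m).tsum_eq
    rw [← Complex.ofReal_tsum] at h1
    have h2 := norm_pairGenFun_le (m := m) (s := 1) (q := (‖q‖ : ℂ)) norm_one (by rw [hn]; exact hq)
    rw [← h1, Complex.norm_real, hn] at h2
    exact (Real.le_norm_self _).trans h2
  have h := hsum.of_norm.hasSum
  have h2 := h.prod_fiberwise fun m =>
    hasSum_overpartitionPairCount (m := m) (s := -1) (by simp) hq
  exact h2.unique ha ▸ h

end GeneratingFunction

/-! ### Conclusion: both sides as hexagonal lattice sums -/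

theorem theorem1p2 (q r : ℂ) (hq0 : 0 < ‖q‖) (hq1 : ‖q‖ < 1) (hr : r ^ 2 = q) :
    Summable (fun n : ℕ => r ^ (3 * n ^ 2) * (1 + q ^ (2 * n + 1)) * (1 + r ^ (2 * n + 1)) *
      ∑ j ∈ Finset.Icc (-(n : ℤ)) (n : ℤ), r ^ (j.natAbs ^ 2)) ∧
    Summable (fun n : ℕ => (-1 : ℂ) ^ n * r ^ (3 * n ^ 2) * (1 + q ^ (2 * n + 1)) *
      (1 - r ^ (2 * n + 1)) *
      ∑ j ∈ Finset.Icc (-(n : ℤ)) (n : ℤ), (-1 : ℂ) ^ j * r ^ (j.natAbs ^ 2)) ∧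
    HasSum (fun t : ℕ × ℕ × ℕ =>
        (-1 : ℂ) ^ t.2.2 * (overpartitionPairCount t.1 t.2.2 t.2.1 : ℂ) * q ^ t.2.1)
      (1 / 2 * ∑' n : ℕ, r ^ (3 * n ^ 2) * (1 + q ^ (2 * n + 1)) * (1 + r ^ (2 * n + 1)) *
          ∑ j ∈ Finset.Icc (-(n : ℤ)) (n : ℤ), r ^ (j.natAbs ^ 2) +
        1 / 2 * ∑' n : ℕ, (-1 : ℂ) ^ n * r ^ (3 * n ^ 2) * (1 + q ^ (2 * n + 1)) *
          (1 - r ^ (2 * n + 1)) *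
          ∑ j ∈ Finset.Icc (-(n : ℤ)) (n : ℤ), (-1 : ℂ) ^ j * r ^ (j.natAbs ^ 2)) := by
  have hq : q ≠ 0 := norm_pos_iff.1 hq0
  have hr0 : r ≠ 0 := by rintro rfl; exact hq (by rw [← hr]; simp)
  have hr1 : ‖r‖ < 1 := by
    have h : ‖r‖ ^ 2 < 1 := by rw [← norm_pow, hr]; exact hq1
    exact (sq_lt_one_iff₀ (norm_nonneg r)).1 h
  refine ⟨summable_plus_series hq1 hr1, summable_minus_series hq1 hr1, ?_⟩
  rw [tsum_half_series hq hq1 hr hr0 hr1]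
  exact hasSum_signed_pairs hq hq1
    (((hasSum_even_part_hex hq hq1).add ((hasSum_odd_part_hex hq hq1).mul_left q)).congr_fun
      fun m => pairGenFun_neg_one m hq1)
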